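/- Let $d\ge 2$, let $\Omega\subset\mathbb R^d$ be open, and let $\mathbb L^{d-1}=\{n\otimes n: n\in\mathbb R^d,\ |n|=1\}$. Matrices carry the Frobenius norm. **Boundary data.** Let $g:\mathbb R^d\to\mathbb R$ and $R:\mathbb R^d\to\mathbb R^{d\times d}$ be bounded and Lipschitz, and let $M:\mathbb R^d\to\mathbb L^{d-1}$ be such that $R=gM$ and $c_0\le g\le 1-c_0$ for some constant $c_0>0$. Let $\Gamma_s,\Gamma_U,\Gamma_\Theta$ be relatively open subsets of $\partial\Omega$ with $\Gamma_U=\Gamma_\Theta\subset\Gamma_s$. **Lipschitz admissible triples.** Let $(s,U,\Theta)$ be any triple (in particular, any of the regularized triples $(s_\epsilon,U_\epsilon,\Theta_\epsilon)$, $\epsilon>0$) such that $s:\overline\Omega\to[-\tfrac1{d-1},1]$ and $U:\overline\Omega\to\mathbb R^{d\times d}$ are Lipschitz, $\Theta:\overline\Omega\to\mathbb L^{d-1}$, $U=s\Theta$ on $\overline\Omega$ (so $\Theta=U/s$ where $s\ne0$, and $\Theta$ is an arbitrary element of $\mathbb L^{d-1}$ where $s=0$), $s=g$ on $\Gamma_s$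 and $\Theta=M$ on $\Gamma_\Theta$. Put $$E_{\mathrm{uni-m}}[s,\Theta]=\tfrac12\Big(\tfrac{d-1}{d}\int_\Omega|\nabla s|^2\,dx+\int_\Omega s^2|\nabla\Theta|^2\,dx\Big),\qquad \widetilde E_{\mathrm{uni-m}}[s,U]=\tfrac12\Big(-\tfrac1d\int_\Omega|\nabla s|^2\,dx+\int_\Omega|\nabla U|^2\,dx\Big),$$ where $s^2|\nabla\Theta|^2:=0$ on $\{s=0\}$. **Meshes.** Let $H\subset(0,\infty)$ and, for $h\in H$, let $\mathcal T_h$ be a finite conforming simplicial triangulation of $\overline\Omega$ with element diameters at most $h$. Assume that the family is shape regular (there is $\sigma>0$, independent of $h$, such that every element $T$ contains a ball of radius $\sigma\,\mathrm{diam}\,T$) and weakly acute: with nodes $\{x_i\}$ and piecewise linear hat functions $\{\phi_i\}$, $k_{ij}:=-\int_\Omega\nabla\phi_i\cdot\nabla\phi_j\,dx\ge0$ for $i\neq j$. Let $I_h$ be the piecewise linear Lagrange interpolation operator, $(s_h,U_h,\Theta_h):=(I_hs,I_hU,I_h\Theta)$, and $$E^h_{\mathrm{uni-m}}[s_h,\Theta_h]=\tfrac{d-1}{4d}\sum_{i,j}k_{ij}\big(s_h(x_i)-s_h(x_j)\big)^2+\tfrac14\sum_{i,j}k_{ij}\,\tfrac{s_h(x_i)^2+s_h(x_j)^2}{2}\,\big|\Theta_h(x_i)-\Theta_h(x_j)\big|^2,$$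 $$\widetilde E^h_{\mathrm{uni-m}}[s_h,U_h]=\tfrac12\Big(-\tfrac1d\int_\Omega|\nabla s_h|^2\,dx+\int_\Omega|\nabla U_h|^2\,dx\Big).$$ **Then:** (i) For every $h\in H$ such that $\mathcal T_h$ fits $\Gamma_s$ and $\Gamma_\Theta$ (each point of $\Gamma_s$ lies in a simplex of $\mathcal T_h$, of any dimension, all of whose vertices lie in $\overline{\Gamma_s}$; likewise for $\Gamma_\Theta$), the interpolants are discretely admissible: $s_h,U_h,\Theta_h$ are continuous and piecewise linear, $s_h=I_hg$ on $\Gamma_s$, $U_h=I_hR$ on $\Gamma_U$, $\Theta_h=I_hM$ on $\Gamma_\Theta$, $U_h=I_h(s_h\Theta_h)$, $-\tfrac1{d-1}\le s_h\le1$, and $\Theta_h(x_i)\in\mathbb L^{d-1}$ at every node $x_i$. (ii) $\nabla s$ and $\nabla U$ exist a.e. in $\Omega$, $\nabla\Theta$ exists a.e. in $\{s\ne0\}\cap\Omega$, and the integrals in $E_{\mathrm{uni-m}}[s,\Theta]$ and $\widetilde E_{\mathrm{uni-m}}[s,U]$ are finite. (iii) As $h\to0$ in $H$, $$E_{\mathrm{uni-m}}[s,\Theta]=\lim_{h\to0}E^h_{\mathrm{uni-m}}[s_h,\Theta_h]=\lim_{h\to0}\widetilde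 E^h_{\mathrm{uni-m}}[s_h,U_h]=\widetilde E_{\mathrm{uni-m}}[s,U].$$ -/

import Mathlib

open MeasureTheory Set Filter Topology Geometry
open scoped NNReal Gradient

noncomputable section

namespace UniaxialLdG

/-- Euclidean space `ℝᵈ`. -/
abbrev Sp (d : ℕ) : Type := EuclideanSpace ℝ (Fin d)

/-- Real `d × d` matrices. -/
abbrev Mat (d : ℕ) : Type := Matrix (Fin d) (Fin d) ℝ

/-- The set `𝕃^{d-1}` of line tensors `n ⊗ n`, with `n` a unit vector of `ℝᵈ`. -/
def lineTensors (d : ℕ) : Set (Mat d) :=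
  {A | ∃ n : Sp d, ‖n‖ = 1 ∧ ∀ i j, A i j = n i * n j}

/-- The squared Frobenius norm of a matrix. -/
def frobSq {d : ℕ} (A : Mat d) : ℝ := ∑ i, ∑ j, A i j ^ 2

/-- `|∇V|² = ∑ᵢⱼₖ (∂ₖ Vᵢⱼ)²` for a matrix field `V`. The derivative is the pointwise one; for the
(locally) Lipschitz fields considered here it exists almost everywhere and is the weak one. -/
def matGradSq {d : ℕ} (V : Sp d → Mat d) (x : Sp d) : ℝ :=
  ∑ i, ∑ j, ‖∇ (fun y => V y i j) x‖ ^ 2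

/-! ### Continuous problem -/

/-- The energy `E_{uni-m}[s, Θ] = ½ ( (d-1)/d ∫_Ω |∇s|² + ∫_Ω s² |∇Θ|² )`. The second integrand
vanishes on the singular set `{s = 0}`, whatever the value assigned to `∇Θ` there. -/
def energy {d : ℕ} (Ω : Set (Sp d)) (s : Sp d → ℝ) (Θ : Sp d → Mat d) : ℝ :=
  (1 / 2) * (((d : ℝ) - 1) / d * (∫ x in Ω, ‖∇ s x‖ ^ 2) + ∫ x in Ω, s x ^ 2 * matGradSq Θ x)

/-- The energy `Ẽ_{uni-m}[s, U] = ½ ( -(1/d) ∫_Ω |∇s|² + ∫_Ω |∇U|² )`. On finite element functions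
the discrete energy `Ẽʰ_{uni-m}[s_h, U_h]` is given by the same formula. -/
def energyTilde {d : ℕ} (Ω : Set (Sp d)) (s : Sp d → ℝ) (U : Sp d → Mat d) : ℝ :=
  (1 / 2) * (-(1 / (d : ℝ)) * (∫ x in Ω, ‖∇ s x‖ ^ 2) + ∫ x in Ω, matGradSq U x)

/-- The gradients in `energy` and `energyTilde` exist almost everywhere (that of `Θ` outside the
singular set), and the three integrals are finite. -/
structure EnergyWellDefined {d : ℕ} (Ω : Set (Sp d)) (s : Sp d → ℝ) (U Θ : Sp d → Mat d) :
    Prop where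
  differentiable_s : ∀ᵐ x ∂(volume.restrict Ω), DifferentiableAt ℝ s x
  differentiable_U : ∀ᵐ x ∂(volume.restrict Ω),
    ∀ i j, DifferentiableAt ℝ (fun y => U y i j) x
  differentiable_Θ : ∀ᵐ x ∂(volume.restrict Ω), s x ≠ 0 →
    ∀ i j, DifferentiableAt ℝ (fun y => Θ y i j) x
  integrable_s : IntegrableOn (fun x => ‖∇ s x‖ ^ 2) Ω
  integrable_U : IntegrableOn (fun x => matGradSq U x) Ω
  integrable_Θ : IntegrableOn (fun x => s x ^ 2 * matGradSq Θ x) Ω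

/-- `Γ` is a relatively open subset of the boundary of `Ω`. -/
def IsOpenInBoundary {d : ℕ} (Ω Γ : Set (Sp d)) : Prop :=
  ∃ V : Set (Sp d), IsOpen V ∧ Γ = V ∩ frontier Ω

/-- Dirichlet data `(g, R, M)` with bounded Lipschitz `g`, `R` on `ℝᵈ`, with `R = g M`, `M` valued
in line tensors and `c₀ ≤ g ≤ 1 - c₀` for some `c₀ > 0`, together with the parts `Γs`, `ΓU`, `ΓΘ` of
the boundary where they are imposed. (`R` is bounded since `g` and `M` are. Since `M = R / g` a.e. is
Lipschitz, its continuous representative is used and the pointwise relations hold everywhere.) -/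
structure IsBoundaryData {d : ℕ} (Ω : Set (Sp d)) (g : Sp d → ℝ) (R M : Sp d → Mat d)
    (Γs ΓU ΓΘ : Set (Sp d)) : Prop where
  lipschitz_g : ∃ K : ℝ≥0, LipschitzWith K g
  lipschitz_R : ∃ K : ℝ≥0, ∀ i j, LipschitzWith K (fun x => R x i j)
  eq_smul : ∀ x, R x = g x • M x
  mem_line : ∀ x, M x ∈ lineTensors d
  away : ∃ c₀ : ℝ, 0 < c₀ ∧ ∀ x, c₀ ≤ g x ∧ g x ≤ 1 - c₀
  open_s : IsOpenInBoundary Ω Γs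
  open_U : IsOpenInBoundary Ω ΓU
  open_Θ : IsOpenInBoundary Ω ΓΘ
  eq_UΘ : ΓU = ΓΘ
  subset_s : ΓΘ ⊆ Γs

/-- A Lipschitz triple `(s, U, Θ)` of the admissible class with boundary conditions: `s` and `U` are
Lipschitz (so they have values on the closure of `Ω` and lie in `W^{1,∞}(Ω) ⊆ H¹(Ω)`, `Ω` being
bounded), `Θ = U / s` where `s ≠ 0`, and `Θ` is any line tensor where `s = 0`. -/
structure IsLipschitzAdmissible {d : ℕ} (Ω : Set (Sp d)) (g : Sp d → ℝ) (M : Sp d → Mat d)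
    (Γs ΓΘ : Set (Sp d)) (s : Sp d → ℝ) (U Θ : Sp d → Mat d) : Prop where
  lipschitz_s : ∃ K : ℝ≥0, LipschitzOnWith K s (closure Ω)
  lipschitz_U : ∃ K : ℝ≥0, ∀ i j, LipschitzOnWith K (fun x => U x i j) (closure Ω)
  range_s : ∀ x ∈ closure Ω, -(1 / ((d : ℝ) - 1)) ≤ s x ∧ s x ≤ 1
  eq_smul : ∀ x ∈ closure Ω, U x = s x • Θ x
  mem_line : ∀ x ∈ closure Ω, Θ x ∈ lineTensors d
  bdry_s : ∀ x ∈ Γs, s x = g x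
  bdry_Θ : ∀ x ∈ ΓΘ, Θ x = M x

/-! ### Meshes and Lagrange interpolation -/

/-- A conforming simplicial triangulation of `Ω`: finitely many simplices, all of them faces of
`d`-dimensional ones, any two of which meet in a common face, with union the closure of `Ω`. -/
structure Triangulation {d : ℕ} (Ω : Set (Sp d)) where
  complex : SimplicialComplex ℝ (Sp d)
  finite : complex.faces.Finite
  pure : ∀ F ∈ complex.faces, ∃ T ∈ complex.faces, F ⊆ T ∧ T.card = d + 1
  covers : complex.space = closure Ω

namespace Triangulation

variable {d : ℕ} {Ω : Set (Sp d)} {F : Type*} [AddCommGroup F] [Module ℝ F]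

/-- The elements: the simplices of dimension `d`, given by their vertices. -/
def elements (𝒯 : Triangulation Ω) : Set (Finset (Sp d)) :=
  {T | T ∈ 𝒯.complex.faces ∧ T.card = d + 1}

theorem finite_vertices (𝒯 : Triangulation Ω) : 𝒯.complex.vertices.Finite :=
  𝒯.finite.preimage (fun _ _ _ _ h => Finset.singleton_injective h)

/-- The nodes (vertices) of the mesh. -/
def nodes (𝒯 : Triangulation Ω) : Finset (Sp d) := 𝒯.finite_vertices.toFinset

/-- `x` is the convex combination of the points of `T` with weights `w`. -/
def IsBary (T : Finset (Sp d)) (w : Sp d → ℝ) (x : Sp d) : Prop :=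
  (∀ z ∈ T, 0 ≤ w z) ∧ ∑ z ∈ T, w z = 1 ∧ ∑ z ∈ T, w z • z = x

open Classical in
/-- The Lagrange (nodal) interpolant `I_h v`: at a point with barycentric coordinates `(w_z)` in a
simplex `T` of the mesh its value is `∑_{z ∈ T} w_z v(z)`; it is extended by `0`. It does not depend
on the simplex chosen, see `interp_eq`. -/
def interp (𝒯 : Triangulation Ω) (v : Sp d → F) (x : Sp d) : F :=
  if h : ∃ p : Finset (Sp d) × (Sp d → ℝ), p.1 ∈ 𝒯.complex.faces ∧ IsBary p.1 p.2 x then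
    ∑ z ∈ h.choose.1, h.choose.2 z • v z
  else 0

open Classical in
theorem sum_extend_weights {G : Type*} [AddCommGroup G] [Module ℝ G] {A S : Finset (Sp d)}
    (hS : A ⊆ S) (u : Sp d → ℝ) (f : Sp d → G) :
    ∑ z ∈ S, (if z ∈ A then u z else 0) • f z = ∑ z ∈ A, u z • f z := by
  rw [← Finset.sum_subset hS (by intro z _ hz; simp [hz])]
  exact Finset.sum_congr rfl (by intro z hz; simp only [hz, if_true])

open Classical in
theorem bary_unique (𝒯 : Triangulation Ω) (v : Sp d → F) {T T' : Finset (Sp d)}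
    {w w' : Sp d → ℝ} {x : Sp d} (hT : T ∈ 𝒯.complex.faces) (hw : IsBary T w x)
    (hT' : T' ∈ 𝒯.complex.faces) (hw' : IsBary T' w' x) :
    ∑ z ∈ T, w z • v z = ∑ z ∈ T', w' z • v z := by
  have key : ∀ {S : Finset (Sp d)} {a b : Sp d → ℝ}, S ∈ 𝒯.complex.faces →
      ∑ z ∈ S, a z = 1 → ∑ z ∈ S, b z = 1 → ∑ z ∈ S, a z • z = ∑ z ∈ S, b z • z →
      ∀ z ∈ S, a z = b z := by
    intro S a b hS ha hb hab z hz
    have := (𝒯.complex.indep hS).eq_zero_of_sum_eq_zero_subtype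
      (w := fun z => a z - b z) (by simp [ha, hb]) (by simp [sub_smul, hab]) z hz
    exact sub_eq_zero.1 this
  have hx : x ∈ convexHull ℝ ((T ∩ T' : Finset (Sp d)) : Set (Sp d)) := by
    rw [Finset.coe_inter]
    exact 𝒯.complex.inter_subset_convexHull hT hT'
      ⟨Finset.mem_convexHull'.2 ⟨w, hw⟩, Finset.mem_convexHull'.2 ⟨w', hw'⟩⟩
  obtain ⟨u, -, hu1, hux⟩ := Finset.mem_convexHull'.1 hx
  have main : ∀ {S : Finset (Sp d)} {a : Sp d → ℝ}, S ∈ 𝒯.complex.faces → T ∩ T' ⊆ S →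
      IsBary S a x → ∑ z ∈ S, a z • v z = ∑ z ∈ T ∩ T', u z • v z := by
    intro S a hS hsub ha
    rw [← sum_extend_weights hsub u v]
    refine Finset.sum_congr rfl fun z hz => ?_
    rw [key (b := fun z => if z ∈ T ∩ T' then u z else 0) hS ha.2.1 ?_ ?_ z hz]
    · have := sum_extend_weights hsub u (fun _ => (1 : ℝ))
      simpa [hu1] using this
    · rw [ha.2.2, sum_extend_weights hsub u (fun z => z), hux]
  rw [main hT Finset.inter_subset_left hw, main hT' Finset.inter_subset_right hw']

/-- The interpolant is well defined. -/
theorem interp_eq (𝒯 : Triangulation Ω) (v : Sp d → F) {T : Finset (Sp d)} {w : Sp d → ℝ}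
    {x : Sp d} (hT : T ∈ 𝒯.complex.faces) (hw : IsBary T w x) :
    𝒯.interp v x = ∑ z ∈ T, w z • v z := by
  have h : ∃ p : Finset (Sp d) × (Sp d → ℝ), p.1 ∈ 𝒯.complex.faces ∧ IsBary p.1 p.2 x :=
    ⟨(T, w), hT, hw⟩
  rw [interp, dif_pos h]
  exact 𝒯.bary_unique v h.choose_spec.1 h.choose_spec.2 hT hw

open Classical in
/-- The piecewise linear hat function of the node `z`. -/
def hat (𝒯 : Triangulation Ω) (z : Sp d) : Sp d → ℝ :=
  𝒯.interp (fun y => if y = z then 1 else 0)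

/-- The entries `k_{zy} = -∫_Ω ∇φ_z · ∇φ_y`. -/
def stiffness (𝒯 : Triangulation Ω) (z y : Sp d) : ℝ :=
  -∫ x in Ω, inner ℝ (∇ (𝒯.hat z) x) (∇ (𝒯.hat y) x)

/-- The mesh is weakly acute. -/
def WeaklyAcute (𝒯 : Triangulation Ω) : Prop :=
  ∀ z ∈ 𝒯.nodes, ∀ y ∈ 𝒯.nodes, z ≠ y → 0 ≤ 𝒯.stiffness z y

/-- Every element has diameter at most `h`. -/
def SizeLE (𝒯 : Triangulation Ω) (h : ℝ) : Prop :=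
  ∀ T ∈ 𝒯.elements, Metric.diam (convexHull ℝ (T : Set (Sp d))) ≤ h

/-- Every element contains a ball whose radius is `σ` times the diameter of the element. -/
def ShapeRegular (𝒯 : Triangulation Ω) (σ : ℝ) : Prop :=
  ∀ T ∈ 𝒯.elements, ∃ c : Sp d,
    Metric.ball c (σ * Metric.diam (convexHull ℝ (T : Set (Sp d)))) ⊆
      convexHull ℝ (T : Set (Sp d))

/-- The mesh fits the boundary part `Γ`: each point of `Γ` lies in a simplex (a face) of the mesh
whose vertices all lie in the closure of `Γ`. -/
def Fits (𝒯 : Triangulation Ω) (Γ : Set (Sp d)) : Prop :=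
  ∀ x ∈ Γ, ∃ S ∈ 𝒯.complex.faces,
    (S : Set (Sp d)) ⊆ closure Γ ∧ x ∈ convexHull ℝ (S : Set (Sp d))

/-- Continuous piecewise linear finite element functions. -/
def IsP1 [TopologicalSpace F] (𝒯 : Triangulation Ω) (v : Sp d → F) : Prop :=
  ContinuousOn v (closure Ω) ∧
    ∀ T ∈ 𝒯.elements, ∃ A : Sp d →ᵃ[ℝ] F, EqOn v A (convexHull ℝ (T : Set (Sp d)))

/-- The discrete admissible class with the interpolated Dirichlet data `I_h g`, `I_h R`, `I_h M`. -/
structure IsDiscreteAdmissible (𝒯 : Triangulation Ω) (g : Sp d → ℝ) (R M : Sp d → Mat d)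
    (Γs ΓU ΓΘ : Set (Sp d)) (sh : Sp d → ℝ) (Uh Θh : Sp d → Mat d) : Prop where
  p1_s : 𝒯.IsP1 sh
  p1_U : 𝒯.IsP1 Uh
  p1_Θ : 𝒯.IsP1 Θh
  bdry_s : ∀ x ∈ Γs, sh x = 𝒯.interp g x
  bdry_U : ∀ x ∈ ΓU, Uh x = 𝒯.interp R x
  bdry_Θ : ∀ x ∈ ΓΘ, Θh x = 𝒯.interp M x
  eq_interp : ∀ x ∈ closure Ω, Uh x = 𝒯.interp (fun y => sh y • Θh y) x
  range_s : ∀ x ∈ closure Ω, -(1 / ((d : ℝ) - 1)) ≤ sh x ∧ sh x ≤ 1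
  mem_line : ∀ z ∈ 𝒯.nodes, Θh z ∈ lineTensors d

/-- The discrete energy `Eʰ_{uni-m}[s_h, Θ_h]`. -/
def discreteEnergy (𝒯 : Triangulation Ω) (sh : Sp d → ℝ) (Θh : Sp d → Mat d) : ℝ :=
  ((d : ℝ) - 1) / (4 * d) *
      (∑ z ∈ 𝒯.nodes, ∑ y ∈ 𝒯.nodes, 𝒯.stiffness z y * (sh z - sh y) ^ 2) +
    (1 / 4) * ∑ z ∈ 𝒯.nodes, ∑ y ∈ 𝒯.nodes,
      𝒯.stiffness z y * ((sh z ^ 2 + sh y ^ 2) / 2) * frobSq (Θh z - Θh y)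

end Triangulation

end UniaxialLdG

end

namespace UniaxialLdG

/-! Everything rests on |Θ| = 1 for line tensors. Differentiating |Θ|² = 1 gives Θ : ∂ₖΘ = 0, so U =
sΘ yields |∇U|² = |∇s|² + s²|∇Θ|² where s ≠ 0 (`matGradSq_eq`). Where s = 0 also U = 0, and the
gradient of a Lipschitz function vanishes a.e. on its zero set (`ae_gradient_eq_zero_of_eq_zero`).
The identity thus holds a.e. in Ω, and the two continuous energies agree because (d-1)/d = 1 - 1/d.

The nodal counterpart of this identity, `average_mul_frobSq_sub`, has a remainder. Summed against
the stiffness entries it gives Eʰ = Ẽʰ - (1/8) ∫ `excess` (`discreteEnergy_eq`), where the excess is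
the sum over z, y of ∇φ_z · ∇φ_y (s(z) - s(y))² |Θ(z) - Θ(y)|².

The limits follow by dominated convergence. On an element of diameter D, shape regularity gives
|∇φ_z| ≤ 1/(σD), so Lipschitz bounds dominate the integrands uniformly in h, and Taylor expansion
gives ∇I_h v → ∇v wherever v is differentiable, up to element boundaries
(`tendsto_gradient_interp`). The excess also tends to 0 a.e. (`tendsto_excess`): where s ≠ 0, Θ is
continuous and the differences of s are O(D); where s = 0, a.e. ∇s = 0, so these differences are
o(D) while Θ is bounded. No regularity of Θ on the singular set is needed.

For discrete admissibility, interpolants on a fitted Γ depend only on values on the closure of Γ, to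
which the boundary identities extend. -/

theorem gradient_finset_sum_smul {d : ℕ} {ι : Type*} (T : Finset ι) (f : ι → Sp d → ℝ) (c : ι → ℝ)
    {x : Sp d} (hf : ∀ i ∈ T, DifferentiableAt ℝ (f i) x) :
    ∇ (fun y => ∑ i ∈ T, c i * f i y) x = ∑ i ∈ T, c i • ∇ (f i) x := by
  have h : HasFDerivAt (fun y => ∑ i ∈ T, c i * f i y) (∑ i ∈ T, c i • fderiv ℝ (f i) x) x := by
    refine HasFDerivAt.fun_sum fun i hi => ?_
    exact (hf i hi).hasFDerivAt.const_mul (c i)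
  simp only [gradient, h.fderiv, map_sum, map_smulₛₗ]
  simp

/-! ### Hat functions as barycentric coordinates; size and interior of the mesh. -/

namespace Triangulation

variable {d : ℕ} {Ω : Set (Sp d)} {F : Type*} [AddCommGroup F] [Module ℝ F]

theorem hat_of_mem (𝒯 : Triangulation Ω) {T : Finset (Sp d)} {w : Sp d → ℝ} {x z : Sp d}
    (hT : T ∈ 𝒯.complex.faces) (hw : IsBary T w x) (hz : z ∈ T) : 𝒯.hat z x = w z := by
  classical
  rw [hat, 𝒯.interp_eq _ hT hw]
  simp [hz]

theorem hat_of_notMem (𝒯 : Triangulation Ω) {T : Finset (Sp d)} {x z : Sp d}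
    (hT : T ∈ 𝒯.complex.faces) (hx : x ∈ convexHull ℝ (T : Set (Sp d))) (hz : z ∉ T) :
    𝒯.hat z x = 0 := by
  classical
  obtain ⟨w, hw⟩ := Finset.mem_convexHull'.1 hx
  rw [hat, 𝒯.interp_eq _ hT hw]
  simp [hz]

/-- On a simplex of the mesh the hat functions of its vertices are the barycentric coordinates. -/
theorem isBary_hat (𝒯 : Triangulation Ω) {T : Finset (Sp d)} {x : Sp d}
    (hT : T ∈ 𝒯.complex.faces) (hx : x ∈ convexHull ℝ (T : Set (Sp d))) :
    IsBary T (fun z => 𝒯.hat z x) x := by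
  obtain ⟨w, hw⟩ := Finset.mem_convexHull'.1 hx
  have key : ∀ z ∈ T, 𝒯.hat z x = w z := fun z hz => 𝒯.hat_of_mem hT hw hz
  refine ⟨fun z hz => (hw.1 z hz).trans_eq (key z hz).symm, ?_, ?_⟩
  · rw [Finset.sum_congr rfl key, hw.2.1]
  · rw [← hw.2.2]
    exact Finset.sum_congr rfl fun z hz => by simp only [hw.2.2, key z hz]

theorem interp_eq_sum_hat (𝒯 : Triangulation Ω) (v : Sp d → F) {T : Finset (Sp d)} {x : Sp d}
    (hT : T ∈ 𝒯.complex.faces) (hx : x ∈ convexHull ℝ (T : Set (Sp d))) :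
    𝒯.interp v x = ∑ z ∈ T, 𝒯.hat z x • v z :=
  𝒯.interp_eq v hT (𝒯.isBary_hat hT hx)

theorem mem_nodes (𝒯 : Triangulation Ω) {z : Sp d} : z ∈ 𝒯.nodes ↔ {z} ∈ 𝒯.complex.faces := by
  simp [nodes, SimplicialComplex.vertices]

theorem subset_nodes (𝒯 : Triangulation Ω) {T : Finset (Sp d)} (hT : T ∈ 𝒯.complex.faces) :
    T ⊆ 𝒯.nodes := fun z hz =>
  𝒯.mem_nodes.2 (𝒯.complex.down_closed hT (Finset.singleton_subset_iff.2 hz) (by simp))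

theorem interp_node (𝒯 : Triangulation Ω) (v : Sp d → F) {z : Sp d} (hz : z ∈ 𝒯.nodes) :
    𝒯.interp v z = v z := by
  rw [𝒯.interp_eq v (w := fun _ => 1) (𝒯.mem_nodes.1 hz) (by simp [IsBary])]
  simp

theorem convexHull_subset (𝒯 : Triangulation Ω) {T : Finset (Sp d)} (hT : T ∈ 𝒯.complex.faces) :
    convexHull ℝ (T : Set (Sp d)) ⊆ closure Ω :=
  𝒯.covers ▸ 𝒯.complex.convexHull_subset_space hT

theorem nodes_subset (𝒯 : Triangulation Ω) {z : Sp d} (hz : z ∈ 𝒯.nodes) : z ∈ closure Ω :=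
  𝒯.convexHull_subset (𝒯.mem_nodes.1 hz) (subset_convexHull ℝ _ (by simp))

theorem finite_elements (𝒯 : Triangulation Ω) : 𝒯.elements.Finite :=
  𝒯.finite.subset fun _ h => h.1

theorem closure_eq_biUnion (𝒯 : Triangulation Ω) :
    closure Ω = ⋃ T ∈ 𝒯.elements, convexHull ℝ (T : Set (Sp d)) := by
  refine Subset.antisymm (fun x hx => ?_) (iUnion₂_subset fun T hT => 𝒯.convexHull_subset hT.1)
  rw [← 𝒯.covers, SimplicialComplex.mem_space_iff] at hx
  obtain ⟨S, hS, hx⟩ := hx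
  obtain ⟨T, hT, hST, hc⟩ := 𝒯.pure S hS
  exact mem_biUnion (show T ∈ 𝒯.elements from ⟨hT, hc⟩) (convexHull_mono (by exact_mod_cast hST) hx)

/-- A finite union of simplices is compact; this is where boundedness of Ω comes from. -/
theorem isCompact_closure (𝒯 : Triangulation Ω) : IsCompact (closure Ω) := by
  rw [𝒯.closure_eq_biUnion]
  exact 𝒯.finite_elements.isCompact_biUnion fun T _ => T.finite_toSet.isCompact_convexHull ℝ

theorem volume_lt_top (𝒯 : Triangulation Ω) : volume Ω < ⊤ :=
  (measure_mono subset_closure).trans_lt 𝒯.isCompact_closure.measure_lt_top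

theorem isClosed_convexHull (T : Finset (Sp d)) : IsClosed (convexHull ℝ (T : Set (Sp d))) :=
  (T.finite_toSet.isCompact_convexHull ℝ).isClosed

/-- Frontiers of convex sets are Lebesgue null, and there are finitely many elements. -/
theorem ae_mem_interior (𝒯 : Triangulation Ω) (hΩ : IsOpen Ω) :
    ∀ᵐ x ∂(volume.restrict Ω), ∃ T ∈ 𝒯.elements, x ∈ interior (convexHull ℝ (T : Set (Sp d))) := by
  have h0 : ∀ᵐ x ∂(volume.restrict Ω), ∀ T ∈ 𝒯.elements,
      x ∉ frontier (convexHull ℝ (T : Set (Sp d))) := by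
    refine (ae_ball_iff 𝒯.finite_elements.countable).2 fun T _ => ?_
    refine ae_restrict_of_ae (measure_eq_zero_iff_ae_notMem.1 ?_)
    exact (convex_convexHull ℝ _).addHaar_frontier _
  filter_upwards [h0, ae_restrict_mem hΩ.measurableSet] with x hx hxΩ
  have hxc := subset_closure hxΩ
  rw [𝒯.closure_eq_biUnion, mem_iUnion₂] at hxc
  obtain ⟨T, hT, hxT⟩ := hxc
  refine ⟨T, hT, by_contra fun hn => hx T hT ⟨subset_closure hxT, hn⟩⟩

/-- The d + 1 vertices of an element form an affine basis, whose coordinate maps are the hat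
functions of the vertices; the other hat functions vanish there. -/
theorem exists_affine_hat (𝒯 : Triangulation Ω) {T : Finset (Sp d)} (hT : T ∈ 𝒯.elements)
    (z : Sp d) :
    ∃ A : Sp d →ᵃ[ℝ] ℝ, EqOn (𝒯.hat z) A (convexHull ℝ (T : Set (Sp d))) := by
  classical
  by_cases hz : z ∈ T
  swap
  · exact ⟨0, fun x hx => by simpa using 𝒯.hat_of_notMem hT.1 hx hz⟩
  have hi : AffineIndependent ℝ ((↑) : T → Sp d) := 𝒯.complex.indep hT.1
  have hs : affineSpan ℝ (range ((↑) : T → Sp d)) = ⊤ := by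
    rw [hi.affineSpan_eq_top_iff_card_eq_finrank_add_one]
    simp [hT.2]
  let b : AffineBasis T ℝ (Sp d) := ⟨(↑), hi, hs⟩
  refine ⟨b.coord ⟨z, hz⟩, fun x hx => ?_⟩
  obtain ⟨w, hw⟩ := Finset.mem_convexHull'.1 hx
  rw [𝒯.hat_of_mem hT.1 hw hz]
  have h1 : ∑ i : T, w i = 1 := by rw [Finset.sum_coe_sort T w]; exact hw.2.1
  have h2 : Finset.univ.affineCombination ℝ b (fun i : T => w i) = x := by
    rw [Finset.affineCombination_eq_linear_combination _ _ _ h1, ← hw.2.2]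
    exact Finset.sum_coe_sort T (fun z => w z • z)
  have := b.coord_apply_combination_of_mem (Finset.mem_univ (⟨z, hz⟩ : T)) h1
  rw [h2] at this
  exact this.symm

theorem hat_mem_Icc (𝒯 : Triangulation Ω) {T : Finset (Sp d)} {x : Sp d}
    (hT : T ∈ 𝒯.complex.faces) (hx : x ∈ convexHull ℝ (T : Set (Sp d))) (z : Sp d) :
    𝒯.hat z x ∈ Icc (0 : ℝ) 1 := by
  by_cases hz : z ∈ T
  · have h := 𝒯.isBary_hat hT hx
    exact ⟨h.1 z hz, h.2.1 ▸ Finset.single_le_sum h.1 hz⟩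
  · simp [𝒯.hat_of_notMem hT hx hz]

/-! ### Gradients of hat functions and of interpolants. -/

theorem hasFDerivAt_hat (𝒯 : Triangulation Ω) {T : Finset (Sp d)} (hT : T ∈ 𝒯.elements)
    (z : Sp d) :
    ∃ A : Sp d →ᵃ[ℝ] ℝ, EqOn (𝒯.hat z) A (convexHull ℝ (T : Set (Sp d))) ∧
      ∀ x ∈ interior (convexHull ℝ (T : Set (Sp d))),
        HasFDerivAt (𝒯.hat z) (LinearMap.toContinuousLinearMap A.linear) x := by
  obtain ⟨A, hA⟩ := 𝒯.exists_affine_hat hT z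
  refine ⟨A, hA, fun x hx => ?_⟩
  have h : HasFDerivAt A (LinearMap.toContinuousLinearMap A.linear) x := by
    have h2 := (LinearMap.toContinuousLinearMap A.linear).hasFDerivAt (x := x)
    have h3 := h2.add_const (A 0)
    refine h3.congr_of_eventuallyEq (Eventually.of_forall fun y => ?_)
    rw [A.decomp]; simp
  exact h.congr_of_eventuallyEq
    (eventuallyEq_of_mem (mem_interior_iff_mem_nhds.1 hx) hA)

theorem differentiableAt_hat (𝒯 : Triangulation Ω) {T : Finset (Sp d)} (hT : T ∈ 𝒯.elements)
    {x : Sp d} (hx : x ∈ interior (convexHull ℝ (T : Set (Sp d)))) (z : Sp d) :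
    DifferentiableAt ℝ (𝒯.hat z) x :=
  let ⟨_, _, h⟩ := 𝒯.hasFDerivAt_hat hT z
  (h x hx).differentiableAt

/-- An affine function with values in [0, 1] on a ball of radius r changes by at most 1 from the
centre, hence has slope at most 1/r. -/
theorem norm_gradient_hat_le (𝒯 : Triangulation Ω) {T : Finset (Sp d)} (hT : T ∈ 𝒯.elements)
    {x : Sp d} (hx : x ∈ interior (convexHull ℝ (T : Set (Sp d)))) (z : Sp d) {c : Sp d} {r : ℝ}
    (hr : 0 < r) (hc : Metric.ball c r ⊆ convexHull ℝ (T : Set (Sp d))) :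
    ‖∇ (𝒯.hat z) x‖ ≤ 1 / r := by
  obtain ⟨A, hA, hd⟩ := 𝒯.hasFDerivAt_hat hT z
  have hc' : Metric.closedBall c r ⊆ convexHull ℝ (T : Set (Sp d)) := by
    rw [← closure_ball c hr.ne']
    exact closure_minimal hc (isClosed_convexHull T)
  rw [gradient, LinearIsometryEquiv.norm_map, (hd x hx).fderiv]
  refine ContinuousLinearMap.opNorm_bound_of_ball_bound hr 1 _ fun y hy => ?_
  have h1 : c ∈ convexHull ℝ (T : Set (Sp d)) := hc' (Metric.mem_closedBall_self hr.le)
  have h2 : y + c ∈ convexHull ℝ (T : Set (Sp d)) := hc' (by simpa using hy)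
  have e : A.linear y = A (y + c) - A c := by
    have := A.map_vadd c y
    simp only [vadd_eq_add] at this
    rw [this]; ring
  have h3 := 𝒯.hat_mem_Icc hT.1 h1 z
  have h4 := 𝒯.hat_mem_Icc hT.1 h2 z
  rw [hA h1] at h3
  rw [hA h2] at h4
  simp only [LinearMap.coe_toContinuousLinearMap', e, Real.norm_eq_abs, abs_le]
  constructor <;> linarith [h3.1, h3.2, h4.1, h4.2]

theorem gradient_hat_of_notMem (𝒯 : Triangulation Ω) {T : Finset (Sp d)} (hT : T ∈ 𝒯.elements)
    {x : Sp d} (hx : x ∈ interior (convexHull ℝ (T : Set (Sp d)))) {z : Sp d} (hz : z ∉ T) :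
    ∇ (𝒯.hat z) x = 0 := by
  have : 𝒯.hat z =ᶠ[𝓝 x] fun _ => 0 :=
    eventuallyEq_of_mem (mem_interior_iff_mem_nhds.1 hx) fun y hy => 𝒯.hat_of_notMem hT.1 hy hz
  rw [this.gradient.eq_of_nhds, gradient_fun_const]

theorem gradient_interp (𝒯 : Triangulation Ω) (v : Sp d → ℝ) {T : Finset (Sp d)}
    (hT : T ∈ 𝒯.elements) {x : Sp d} (hx : x ∈ interior (convexHull ℝ (T : Set (Sp d)))) :
    ∇ (𝒯.interp v) x = ∑ z ∈ T, v z • ∇ (𝒯.hat z) x := by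
  have : 𝒯.interp v =ᶠ[𝓝 x] fun y => ∑ z ∈ T, v z * 𝒯.hat z y :=
    eventuallyEq_of_mem (mem_interior_iff_mem_nhds.1 hx) fun y hy => by
      simp only [𝒯.interp_eq_sum_hat v hT.1 hy, smul_eq_mul, mul_comm]
  rw [this.gradient.eq_of_nhds, gradient_finset_sum_smul _ _ _ fun z _ => 𝒯.differentiableAt_hat hT hx z]

/-- The hat functions of the vertices form a partition of unity on the element. -/
theorem sum_gradient_hat (𝒯 : Triangulation Ω) {T : Finset (Sp d)}
    (hT : T ∈ 𝒯.elements) {x : Sp d} (hx : x ∈ interior (convexHull ℝ (T : Set (Sp d)))) :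
    ∑ z ∈ T, ∇ (𝒯.hat z) x = 0 := by
  have h := 𝒯.gradient_interp (fun _ => 1) hT hx
  have : 𝒯.interp (fun _ => (1 : ℝ)) =ᶠ[𝓝 x] fun _ => 1 :=
    eventuallyEq_of_mem (mem_interior_iff_mem_nhds.1 hx) fun y hy => by
      simpa [𝒯.interp_eq_sum_hat _ hT.1 hy] using (𝒯.isBary_hat hT.1 hy).2.1
  rw [this.gradient.eq_of_nhds, gradient_fun_const] at h
  simpa using h.symm

/-- Interpolation reproduces linear functions, and the shift by x drops out since the gradients sum
to zero. This lets a Taylor polynomial be subtracted at the nodes. -/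
theorem sum_inner_smul_gradient_hat (𝒯 : Triangulation Ω) {T : Finset (Sp d)}
    (hT : T ∈ 𝒯.elements) {x : Sp d} (hx : x ∈ interior (convexHull ℝ (T : Set (Sp d))))
    (a : Sp d) :
    ∑ z ∈ T, inner ℝ a (z - x) • ∇ (𝒯.hat z) x = a := by
  have h := 𝒯.gradient_interp (fun z => inner ℝ a z) hT hx
  have : 𝒯.interp (fun z => inner ℝ a z) =ᶠ[𝓝 x] fun y => inner ℝ a y :=
    eventuallyEq_of_mem (mem_interior_iff_mem_nhds.1 hx) fun y hy => by
      have := (𝒯.isBary_hat hT.1 hy).2.2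
      simp only [𝒯.interp_eq_sum_hat _ hT.1 hy]
      conv_rhs => rw [← this]
      simp [inner_sum, inner_smul_right]
  have h2 : ∇ (fun y : Sp d => inner ℝ a y) x = a := by
    refine HasGradientAt.gradient ?_
    rw [hasGradientAt_iff_hasFDerivAt]
    exact (InnerProductSpace.toDual ℝ (Sp d) a).hasFDerivAt
  rw [this.gradient.eq_of_nhds, h2] at h
  simp only [inner_sub_right, sub_smul, Finset.sum_sub_distrib, ← h, ← Finset.smul_sum,
    𝒯.sum_gradient_hat hT hx, smul_zero, sub_zero]

/-- Relation between the nodal quadratic form and the Dirichlet integrand. -/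
theorem sum_sum_inner_mul_sq {ι E : Type*} [NormedAddCommGroup E] [InnerProductSpace ℝ E]
    (T : Finset ι) (b : ι → E) (hb : ∑ z ∈ T, b z = 0) (v : ι → ℝ) :
    ∑ z ∈ T, ∑ y ∈ T, inner ℝ (b z) (b y) * (v z - v y) ^ 2 = -2 * ‖∑ z ∈ T, v z • b z‖ ^ 2 := by
  have h1 : ∀ c : ι → ℝ, ∑ z ∈ T, ∑ y ∈ T, inner ℝ (b z) (b y) * c z = 0 := fun c => by
    refine Finset.sum_eq_zero fun z _ => ?_
    rw [← Finset.sum_mul, ← inner_sum, hb, inner_zero_right, zero_mul]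
  have h2 : ∑ z ∈ T, ∑ y ∈ T, inner ℝ (b z) (b y) * v y ^ 2 = 0 := by
    rw [Finset.sum_comm, ← h1 fun z => v z ^ 2]
    exact Finset.sum_congr rfl fun z _ => Finset.sum_congr rfl fun y _ => by
      rw [real_inner_comm]
  have h3 : ‖∑ z ∈ T, v z • b z‖ ^ 2 = ∑ z ∈ T, ∑ y ∈ T, inner ℝ (b z) (b y) * (v z * v y) := by
    rw [← real_inner_self_eq_norm_sq, sum_inner]
    refine Finset.sum_congr rfl fun z _ => ?_
    rw [inner_sum]
    refine Finset.sum_congr rfl fun y _ => ?_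
    rw [real_inner_smul_left, real_inner_smul_right]; ring
  rw [h3, Finset.mul_sum]
  -- The two zeros are replaced by the vanishing double sums of the terms in `v z ^ 2` and `v y ^
  -- 2`, so that the expanded square matches term by term.
  rw [← sub_eq_zero, ← add_zero (0 : ℝ)]
  nth_rewrite 1 [← h1 fun z => v z ^ 2]
  rw [← h2, ← Finset.sum_sub_distrib, ← Finset.sum_add_distrib]
  refine Finset.sum_congr rfl fun z _ => ?_
  rw [Finset.mul_sum, ← Finset.sum_sub_distrib, ← Finset.sum_add_distrib]
  exact Finset.sum_congr rfl fun y _ => by ring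

end Triangulation
end UniaxialLdG

namespace UniaxialLdG

theorem gradient_measurable {d : ℕ} (f : Sp d → ℝ) : Measurable (∇ f) :=
  (InnerProductSpace.toDual ℝ (Sp d)).symm.continuous.measurable.comp (measurable_fderiv ℝ f)

theorem hasFDerivAt_toDual_gradient {d : ℕ} {f : Sp d → ℝ} {x : Sp d}
    (hf : DifferentiableAt ℝ f x) :
    HasFDerivAt f (InnerProductSpace.toDual ℝ (Sp d) (∇ f x)) x :=
  hasGradientAt_iff_hasFDerivAt.1 hf.hasGradientAt

/-! ### Lipschitz functions on an open set -/

theorem ae_differentiableAt_of_lipschitzOn {d : ℕ} {Ω : Set (Sp d)} (hΩ : IsOpen Ω)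
    {f : Sp d → ℝ} {K : ℝ≥0} (hf : LipschitzOnWith K f Ω) :
    ∀ᵐ x ∂(volume.restrict Ω), DifferentiableAt ℝ f x := by
  rw [ae_restrict_iff' hΩ.measurableSet]
  filter_upwards [hf.ae_differentiableWithinAt_of_mem] with x hx hxΩ
  exact (hx hxΩ).differentiableAt (hΩ.mem_nhds hxΩ)

theorem norm_gradient_le_of_lipschitzOn {d : ℕ} {Ω : Set (Sp d)} (hΩ : IsOpen Ω)
    {f : Sp d → ℝ} {K : ℝ≥0} (hf : LipschitzOnWith K f Ω) {x : Sp d} (hx : x ∈ Ω) :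
    ‖∇ f x‖ ≤ K := by
  rw [gradient, LinearIsometryEquiv.norm_map]
  exact norm_fderiv_le_of_lipschitzOn ℝ (hΩ.mem_nhds hx) hf

theorem integrableOn_sq_norm_gradient {d : ℕ} {Ω : Set (Sp d)} (hv : volume Ω < ⊤)
    {f : Sp d → ℝ} {C : ℝ} (hf : ∀ᵐ x ∂(volume.restrict Ω), ‖∇ f x‖ ≤ C) :
    IntegrableOn (fun x => ‖∇ f x‖ ^ 2) Ω := by
  have : IsFiniteMeasure (volume.restrict Ω) := ⟨by simpa using hv⟩
  refine Integrable.of_bound ((gradient_measurable f).norm.pow_const 2).aestronglyMeasurable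
    (C ^ 2) ?_
  filter_upwards [hf] with x hx
  rw [norm_pow, norm_norm]
  gcongr

/-- The gradient of a Lipschitz function vanishes almost everywhere on its zero set. -/
theorem ae_gradient_eq_zero_of_eq_zero {d : ℕ} {Ω : Set (Sp d)} (hΩ : IsOpen Ω)
    {f : Sp d → ℝ} {K : ℝ≥0} (hf : LipschitzOnWith K f Ω) :
    ∀ᵐ x ∂(volume.restrict Ω), f x = 0 → ∇ f x = 0 := by
  have habs : LipschitzOnWith (1 * K) (fun x => ‖f x‖) Ω :=
    lipschitzWith_one_norm.comp_lipschitzOnWith hf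
  filter_upwards [ae_differentiableAt_of_lipschitzOn hΩ habs] with x hx h0
  -- At a zero of f the function |f| is minimal, so its derivative, if it exists, is 0. Then |f(y)|
  -- = o(|y - x|), which says that f itself has derivative 0.
  have hmin : IsLocalMin (fun x => ‖f x‖) x := Eventually.of_forall fun y => by simp [h0]
  have h1 := hx.hasFDerivAt
  rw [hmin.fderiv_eq_zero, hasFDerivAt_iff_isLittleO] at h1
  have h2 : HasFDerivAt f (0 : Sp d →L[ℝ] ℝ) x := by
    rw [hasFDerivAt_iff_isLittleO, ← Asymptotics.isLittleO_norm_left]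
    simpa [h0] using h1
  rw [gradient, h2.fderiv, map_zero]

/-! ### Line tensors -/

theorem frobSq_nonneg {d : ℕ} (A : Mat d) : 0 ≤ frobSq A :=
  Finset.sum_nonneg fun _ _ => Finset.sum_nonneg fun _ _ => sq_nonneg _

theorem frobSq_of_mem_lineTensors {d : ℕ} {A : Mat d} (hA : A ∈ lineTensors d) :
    frobSq A = 1 := by
  obtain ⟨n, hn, h⟩ := hA
  have h1 : ∑ i, n i ^ 2 = 1 := by
    have := EuclideanSpace.real_norm_sq_eq n
    rw [← this, hn, one_pow]
  simp only [frobSq, h, mul_pow]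
  simp [← Finset.mul_sum, h1]

theorem frobSq_smul_sub_smul {d : ℕ} (a b : ℝ) (A B : Mat d) :
    frobSq (a • A - b • B) =
      a ^ 2 * frobSq A + b ^ 2 * frobSq B - 2 * a * b * ∑ i, ∑ j, A i j * B i j := by
  simp only [frobSq, Finset.mul_sum, ← Finset.sum_add_distrib, ← Finset.sum_sub_distrib]
  refine Finset.sum_congr rfl fun i _ => Finset.sum_congr rfl fun j _ => ?_
  simp only [Matrix.sub_apply, Matrix.smul_apply, smul_eq_mul]
  ring

theorem frobSq_sub {d : ℕ} (A B : Mat d) :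
    frobSq (A - B) = frobSq A + frobSq B - 2 * ∑ i, ∑ j, A i j * B i j := by
  simpa using frobSq_smul_sub_smul 1 1 A B

theorem frobSq_sub_le_four {d : ℕ} {A B : Mat d} (hA : A ∈ lineTensors d)
    (hB : B ∈ lineTensors d) : frobSq (A - B) ≤ 4 := by
  have h := frobSq_nonneg (A + B)
  have h1 := frobSq_smul_sub_smul 1 (-1) A B
  simp only [one_smul, neg_smul, sub_neg_eq_add] at h1
  rw [h1, frobSq_of_mem_lineTensors hA, frobSq_of_mem_lineTensors hB] at h
  rw [frobSq_sub, frobSq_of_mem_lineTensors hA, frobSq_of_mem_lineTensors hB]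
  linarith

/-- For unit A, B one has |aA - bB|² = (a - b)² + ab |A - B|², and (a² + b²)/2 = ab + (a - b)²/2.
The last term on the right is the consistency error of the discrete energy. -/
theorem average_mul_frobSq_sub {d : ℕ} {A B : Mat d} (hA : A ∈ lineTensors d)
    (hB : B ∈ lineTensors d) (a b : ℝ) :
    (a ^ 2 + b ^ 2) / 2 * frobSq (A - B) =
      frobSq (a • A - b • B) - (a - b) ^ 2 + (a - b) ^ 2 * frobSq (A - B) / 2 := by
  rw [frobSq_sub, frobSq_smul_sub_smul, frobSq_of_mem_lineTensors hA,
    frobSq_of_mem_lineTensors hB]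
  ring

/-! ### The continuous energies -/

theorem matGradSq_eq {d : ℕ} {s : Sp d → ℝ} {U Θ : Sp d → Mat d} {x : Sp d}
    (hU : ∀ᶠ y in 𝓝 x, U y = s y • Θ y) (hΘ : ∀ᶠ y in 𝓝 x, frobSq (Θ y) = 1)
    (hs : DifferentiableAt ℝ s x) (hd : ∀ i j, DifferentiableAt ℝ (fun y => Θ y i j) x) :
    matGradSq U x = ‖∇ s x‖ ^ 2 + s x ^ 2 * matGradSq Θ x := by
  have hg : ∀ i j, ∇ (fun y => U y i j) x =
      s x • ∇ (fun y => Θ y i j) x + Θ x i j • ∇ s x := fun i j => by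
    have h1 : (fun y => U y i j) =ᶠ[𝓝 x] fun y => s y * Θ y i j := by
      filter_upwards [hU] with y hy
      simp [hy]
    rw [h1.gradient.eq_of_nhds]
    simp only [gradient]
    rw [fderiv_fun_mul hs (hd i j)]
    simp
  -- The derivative of |Θ|² = 1 in the direction ∇s; it removes the cross term from |∇(sΘ)|².
  have horth : ∑ i, ∑ j, Θ x i j * inner ℝ (∇ (fun y => Θ y i j) x) (∇ s x) = 0 := by
    have h1 : HasFDerivAt (fun y => frobSq (Θ y))
        (∑ i, ∑ j, (2 * Θ x i j) • fderiv ℝ (fun y => Θ y i j) x) x := by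
      refine HasFDerivAt.fun_sum fun i _ => HasFDerivAt.fun_sum fun j _ => ?_
      simpa using (hd i j).hasFDerivAt.pow 2
    have h2 : HasFDerivAt (fun y => frobSq (Θ y)) (0 : Sp d →L[ℝ] ℝ) x :=
      (hasFDerivAt_const (1 : ℝ) x).congr_of_eventuallyEq hΘ
    have h3 := congrArg (fun L => L (∇ s x)) (h1.unique h2)
    simp only [_root_.sum_apply, _root_.smul_apply, smul_eq_mul,
      _root_.zero_apply, mul_assoc, ← Finset.mul_sum] at h3
    have h4 : ∀ i j, fderiv ℝ (fun y => Θ y i j) x (∇ s x) =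
        inner ℝ (∇ (fun y => Θ y i j) x) (∇ s x) := fun i j => by
      simp [gradient]
    simpa [h4] using h3
  have h1 : ∑ i, ∑ j, Θ x i j ^ 2 = 1 := hΘ.self_of_nhds
  have h2 : ∀ i j, ‖∇ (fun y => U y i j) x‖ ^ 2 =
      s x ^ 2 * ‖∇ (fun y => Θ y i j) x‖ ^ 2 +
        2 * s x * (Θ x i j * inner ℝ (∇ (fun y => Θ y i j) x) (∇ s x)) +
        ‖∇ s x‖ ^ 2 * Θ x i j ^ 2 := fun i j => by
    rw [hg, norm_add_sq_real, norm_smul, norm_smul, real_inner_smul_left, real_inner_smul_right,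
      mul_pow, mul_pow, Real.norm_eq_abs, Real.norm_eq_abs, sq_abs, sq_abs]
    ring
  simp only [matGradSq, h2, Finset.sum_add_distrib, ← Finset.mul_sum, horth, h1]
  ring

section Continuous

variable {d : ℕ} {Ω : Set (Sp d)} {g : Sp d → ℝ} {M : Sp d → Mat d} {Γs ΓΘ : Set (Sp d)}
  {s : Sp d → ℝ} {U Θ : Sp d → Mat d}

theorem IsLipschitzAdmissible.eventuallyEq_div (hΩ : IsOpen Ω)
    (hadm : IsLipschitzAdmissible Ω g M Γs ΓΘ s U Θ) {x : Sp d} (hx : x ∈ Ω) (h0 : s x ≠ 0)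
    (i j : Fin d) : (fun y => Θ y i j) =ᶠ[𝓝 x] fun y => U y i j / s y := by
  obtain ⟨K, hK⟩ := hadm.lipschitz_s
  have hc : ContinuousAt s x :=
    (hK.continuousOn.mono subset_closure).continuousAt (hΩ.mem_nhds hx)
  filter_upwards [hc.eventually_ne h0, hΩ.mem_nhds hx] with y hy hyΩ
  rw [hadm.eq_smul y (subset_closure hyΩ), Matrix.smul_apply, smul_eq_mul,
    mul_div_cancel_left₀ _ hy]

theorem IsLipschitzAdmissible.continuousAt (hΩ : IsOpen Ω)
    (hadm : IsLipschitzAdmissible Ω g M Γs ΓΘ s U Θ) {x : Sp d} (hx : x ∈ Ω) (h0 : s x ≠ 0)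
    (i j : Fin d) : ContinuousAt (fun y => Θ y i j) x := by
  obtain ⟨K, hK⟩ := hadm.lipschitz_s
  obtain ⟨L, hL⟩ := hadm.lipschitz_U
  refine ContinuousAt.congr ?_ (hadm.eventuallyEq_div hΩ hx h0 i j).symm
  exact (((hL i j).continuousOn.mono subset_closure).continuousAt (hΩ.mem_nhds hx)).div
    ((hK.continuousOn.mono subset_closure).continuousAt (hΩ.mem_nhds hx)) h0

theorem IsLipschitzAdmissible.ae_differentiableAt_U (hΩ : IsOpen Ω)
    (hadm : IsLipschitzAdmissible Ω g M Γs ΓΘ s U Θ) :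
    ∀ᵐ x ∂(volume.restrict Ω), ∀ i j, DifferentiableAt ℝ (fun y => U y i j) x := by
  obtain ⟨L, hL⟩ := hadm.lipschitz_U
  simp only [ae_all_iff]
  exact fun i j => ae_differentiableAt_of_lipschitzOn hΩ ((hL i j).mono subset_closure)

theorem IsLipschitzAdmissible.ae_matGradSq_eq (hΩ : IsOpen Ω)
    (hadm : IsLipschitzAdmissible Ω g M Γs ΓΘ s U Θ) :
    ∀ᵐ x ∂(volume.restrict Ω),
      (s x ≠ 0 → ∀ i j, DifferentiableAt ℝ (fun y => Θ y i j) x) ∧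
      matGradSq U x = ‖∇ s x‖ ^ 2 + s x ^ 2 * matGradSq Θ x := by
  obtain ⟨K, hK⟩ := hadm.lipschitz_s
  obtain ⟨L, hL⟩ := hadm.lipschitz_U
  have hU0 : ∀ᵐ x ∂(volume.restrict Ω), ∀ i j, U x i j = 0 → ∇ (fun y => U y i j) x = 0 := by
    simp only [ae_all_iff]
    exact fun i j => ae_gradient_eq_zero_of_eq_zero hΩ ((hL i j).mono subset_closure)
  filter_upwards [hU0, ae_gradient_eq_zero_of_eq_zero hΩ (hK.mono subset_closure),
    hadm.ae_differentiableAt_U hΩ, ae_differentiableAt_of_lipschitzOn hΩ (hK.mono subset_closure),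
    ae_restrict_mem hΩ.measurableSet] with x hU0 hs0 hU hs hx
  have hdΘ : s x ≠ 0 → ∀ i j, DifferentiableAt ℝ (fun y => Θ y i j) x := fun h0 i j => by
    refine DifferentiableAt.congr_of_eventuallyEq ?_ (hadm.eventuallyEq_div hΩ hx h0 i j)
    simpa only [div_eq_mul_inv] using (hU i j).fun_mul (hs.fun_inv h0)
  refine ⟨hdΘ, ?_⟩
  by_cases h0 : s x = 0
  -- On the singular set both sides are zero, whatever value ∇Θ takes.
  · have h1 : ∀ i j, ∇ (fun y => U y i j) x = 0 := fun i j => hU0 i j (by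
      rw [hadm.eq_smul x (subset_closure hx), h0]; simp)
    simp [matGradSq, h1, hs0 h0, h0]
  · refine matGradSq_eq ?_ ?_ hs (hdΘ h0)
    · filter_upwards [hΩ.mem_nhds hx] with y hy using hadm.eq_smul y (subset_closure hy)
    · filter_upwards [hΩ.mem_nhds hx] with y hy
      exact frobSq_of_mem_lineTensors (hadm.mem_line y (subset_closure hy))

theorem IsLipschitzAdmissible.energyWellDefined (hΩ : IsOpen Ω) (hv : volume Ω < ⊤)
    (hadm : IsLipschitzAdmissible Ω g M Γs ΓΘ s U Θ) : EnergyWellDefined Ω s U Θ := by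
  obtain ⟨K, hK⟩ := hadm.lipschitz_s
  obtain ⟨L, hL⟩ := hadm.lipschitz_U
  have hI : IntegrableOn (fun x => ‖∇ s x‖ ^ 2) Ω := integrableOn_sq_norm_gradient hv
    ((ae_restrict_mem hΩ.measurableSet).mono fun x hx =>
      norm_gradient_le_of_lipschitzOn hΩ (hK.mono subset_closure) hx)
  have hIU : IntegrableOn (fun x => matGradSq U x) Ω :=
    integrable_finsetSum _ fun i _ => integrable_finsetSum _ fun j _ =>
      integrableOn_sq_norm_gradient hv ((ae_restrict_mem hΩ.measurableSet).mono fun x hx =>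
        norm_gradient_le_of_lipschitzOn hΩ ((hL i j).mono subset_closure) hx)
  have hae := hadm.ae_matGradSq_eq hΩ
  exact
    { differentiable_s := ae_differentiableAt_of_lipschitzOn hΩ (hK.mono subset_closure)
      differentiable_U := hadm.ae_differentiableAt_U hΩ
      differentiable_Θ := hae.mono fun x hx => hx.1
      integrable_s := hI
      integrable_U := hIU
      -- The integrand equals |∇U|² - |∇s|² a.e., so neither measurability nor a bound for ∇Θ has to
      -- be shown separately.
      integrable_Θ := (hIU.sub hI).congr (hae.mono fun x hx => by
        simp only [Pi.sub_apply, hx.2]; ring) }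

theorem IsLipschitzAdmissible.energy_eq_energyTilde (hd : 0 < d) (hΩ : IsOpen Ω)
    (hv : volume Ω < ⊤) (hadm : IsLipschitzAdmissible Ω g M Γs ΓΘ s U Θ) :
    energy Ω s Θ = energyTilde Ω s U := by
  have hw := hadm.energyWellDefined hΩ hv
  have h1 : ∫ x in Ω, matGradSq U x =
      (∫ x in Ω, ‖∇ s x‖ ^ 2) + ∫ x in Ω, s x ^ 2 * matGradSq Θ x := by
    rw [← integral_add hw.integrable_s hw.integrable_Θ]
    exact integral_congr_ae ((hadm.ae_matGradSq_eq hΩ).mono fun x hx => hx.2)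
  have : (d : ℝ) ≠ 0 := by positivity
  rw [energy, energyTilde, h1]
  field_simp
  ring

end Continuous
end UniaxialLdG

namespace UniaxialLdG
namespace Triangulation

variable {d : ℕ} {Ω : Set (Sp d)}

theorem interp_apply (𝒯 : Triangulation Ω) (V : Sp d → Mat d) {x : Sp d} (hx : x ∈ closure Ω)
    (i j : Fin d) : 𝒯.interp V x i j = 𝒯.interp (fun y => V y i j) x := by
  rw [𝒯.closure_eq_biUnion, mem_iUnion₂] at hx
  obtain ⟨T, hT, hx⟩ := hx
  rw [𝒯.interp_eq_sum_hat _ hT.1 hx, 𝒯.interp_eq_sum_hat _ hT.1 hx, Matrix.sum_apply]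
  simp

/-! ### Discrete admissibility -/

section Admissible

variable {F : Type*} [AddCommGroup F] [Module ℝ F]

theorem exists_affine_interp (𝒯 : Triangulation Ω) (v : Sp d → F) {T : Finset (Sp d)}
    (hT : T ∈ 𝒯.elements) :
    ∃ A : Sp d →ᵃ[ℝ] F, EqOn (𝒯.interp v) A (convexHull ℝ (T : Set (Sp d))) := by
  choose A hA using fun z => 𝒯.exists_affine_hat hT z
  refine ⟨∑ z ∈ T, (LinearMap.toSpanSingleton ℝ F (v z)).toAffineMap.comp (A z), fun x hx => ?_⟩
  rw [𝒯.interp_eq_sum_hat v hT.1 hx]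
  have : ∀ S : Finset (Sp d), (∑ z ∈ S,
      (LinearMap.toSpanSingleton ℝ F (v z)).toAffineMap.comp (A z)) x = ∑ z ∈ S, A z x • v z := by
    classical
    intro S
    induction S using Finset.induction_on with
    | empty => simp
    | insert a S ha ih => rw [Finset.sum_insert ha, Finset.sum_insert ha, ← ih]; simp
  rw [this]
  exact Finset.sum_congr rfl fun z _ => by rw [hA z hx]

theorem isP1_interp [TopologicalSpace F] [IsTopologicalAddGroup F] [ContinuousSMul ℝ F]
    (𝒯 : Triangulation Ω) (v : Sp d → F) : 𝒯.IsP1 (𝒯.interp v) := by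
  refine ⟨?_, fun T hT => 𝒯.exists_affine_interp v hT⟩
  rw [𝒯.closure_eq_biUnion, biUnion_eq_iUnion]
  have := 𝒯.finite_elements.to_subtype
  refine (locallyFinite_of_finite _).continuousOn_iUnion (fun T => isClosed_convexHull _) fun T => ?_
  obtain ⟨A, hA⟩ := 𝒯.exists_affine_interp v T.2
  have hc : Continuous A := by
    have h := (LinearMap.continuous_of_finiteDimensional A.linear).add
      (continuous_const (y := A 0))
    rwa [A.decomp]
  exact hc.continuousOn.congr hA

theorem interp_congr_of_fits (𝒯 : Triangulation Ω) {Γ : Set (Sp d)} (hΓ : 𝒯.Fits Γ)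
    {v w : Sp d → F} (h : ∀ z ∈ closure Γ, v z = w z) {x : Sp d} (hx : x ∈ Γ) :
    𝒯.interp v x = 𝒯.interp w x := by
  obtain ⟨S, hS, hSΓ, hxS⟩ := hΓ x hx
  rw [𝒯.interp_eq_sum_hat v hS hxS, 𝒯.interp_eq_sum_hat w hS hxS]
  exact Finset.sum_congr rfl fun z hz => by rw [h z (hSΓ hz)]

theorem interp_congr (𝒯 : Triangulation Ω) {v w : Sp d → F} (h : ∀ z ∈ 𝒯.nodes, v z = w z)
    {x : Sp d} (hx : x ∈ closure Ω) : 𝒯.interp v x = 𝒯.interp w x := by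
  rw [𝒯.closure_eq_biUnion, mem_iUnion₂] at hx
  obtain ⟨T, hT, hx⟩ := hx
  rw [𝒯.interp_eq_sum_hat v hT.1 hx, 𝒯.interp_eq_sum_hat w hT.1 hx]
  exact Finset.sum_congr rfl fun z hz => by rw [h z (𝒯.subset_nodes hT.1 hz)]

theorem interp_mem_of_convex (𝒯 : Triangulation Ω) {C : Set F} (hC : Convex ℝ C) {v : Sp d → F}
    (hv : ∀ z ∈ closure Ω, v z ∈ C) {x : Sp d} (hx : x ∈ closure Ω) : 𝒯.interp v x ∈ C := by
  rw [𝒯.closure_eq_biUnion, mem_iUnion₂] at hx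
  obtain ⟨T, hT, hx⟩ := hx
  rw [𝒯.interp_eq_sum_hat v hT.1 hx]
  have h := 𝒯.isBary_hat hT.1 hx
  exact hC.sum_mem h.1 h.2.1 fun z hz => hv z (𝒯.nodes_subset (𝒯.subset_nodes hT.1 hz))

theorem closure_subset_of_isOpenInBoundary {Γ : Set (Sp d)} (h : IsOpenInBoundary Ω Γ) :
    closure Γ ⊆ closure Ω := by
  obtain ⟨V, -, rfl⟩ := h
  exact closure_minimal (inter_subset_right.trans frontier_subset_closure) isClosed_closure

theorem eqOn_closure_of_eqOn {Γ : Set (Sp d)} (h : IsOpenInBoundary Ω Γ) {f g : Sp d → ℝ}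
    (hf : ContinuousOn f (closure Ω)) (hg : Continuous g) (hfg : ∀ x ∈ Γ, f x = g x) :
    ∀ x ∈ closure Γ, f x = g x := by
  have h1 : EqOn f g Γ := hfg
  exact h1.of_subset_closure (hf.mono (closure_subset_of_isOpenInBoundary h)) hg.continuousOn
    subset_closure subset_rfl

theorem isDiscreteAdmissible_interp (𝒯 : Triangulation Ω) {g : Sp d → ℝ} {R M : Sp d → Mat d}
    {Γs ΓU ΓΘ : Set (Sp d)} (hdata : IsBoundaryData Ω g R M Γs ΓU ΓΘ) {s : Sp d → ℝ}
    {U Θ : Sp d → Mat d} (hadm : IsLipschitzAdmissible Ω g M Γs ΓΘ s U Θ)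
    (hs : 𝒯.Fits Γs) (hΘ : 𝒯.Fits ΓΘ) :
    𝒯.IsDiscreteAdmissible g R M Γs ΓU ΓΘ (𝒯.interp s) (𝒯.interp U) (𝒯.interp Θ) := by
  obtain ⟨K, hK⟩ := hadm.lipschitz_s
  obtain ⟨L, hL⟩ := hadm.lipschitz_U
  obtain ⟨Kg, hKg⟩ := hdata.lipschitz_g
  obtain ⟨KR, hKR⟩ := hdata.lipschitz_R
  obtain ⟨c₀, hc₀, hg⟩ := hdata.away
  have hsg : ∀ x ∈ closure Γs, s x = g x :=
    eqOn_closure_of_eqOn hdata.open_s hK.continuousOn hKg.continuous hadm.bdry_s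
  have hUR : ∀ x ∈ closure ΓΘ, U x = R x := by
    intro x hx
    ext i j
    refine eqOn_closure_of_eqOn hdata.open_Θ (hL i j).continuousOn (hKR i j).continuous
      (fun y hy => ?_) x hx
    rw [hadm.eq_smul y (closure_subset_of_isOpenInBoundary hdata.open_Θ (subset_closure hy)),
      hdata.eq_smul, hadm.bdry_Θ y hy, hadm.bdry_s y (hdata.subset_s hy)]
  -- Θ is not assumed continuous, so its boundary values extend to the closure through U = R and s =
  -- g, dividing by g ≥ c₀ > 0.
  have hΘM : ∀ x ∈ closure ΓΘ, Θ x = M x := by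
    intro x hx
    have h := hUR x hx
    rw [hadm.eq_smul x (closure_subset_of_isOpenInBoundary hdata.open_Θ hx), hdata.eq_smul,
      hsg x (closure_mono hdata.subset_s hx)] at h
    exact smul_right_injective _ (hc₀.trans_le (hg x).1).ne' h
  exact
    { p1_s := 𝒯.isP1_interp s
      p1_U := 𝒯.isP1_interp U
      p1_Θ := 𝒯.isP1_interp Θ
      bdry_s := fun x hx => 𝒯.interp_congr_of_fits hs hsg hx
      bdry_U := fun x hx => 𝒯.interp_congr_of_fits hΘ hUR (hdata.eq_UΘ ▸ hx)
      bdry_Θ := fun x hx => 𝒯.interp_congr_of_fits hΘ hΘM hx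
      eq_interp := fun x hx => 𝒯.interp_congr (fun z hz => by
        rw [𝒯.interp_node s hz, 𝒯.interp_node Θ hz, hadm.eq_smul z (𝒯.nodes_subset hz)]) hx
      range_s := fun x hx => 𝒯.interp_mem_of_convex (convex_Icc _ _) hadm.range_s hx
      mem_line := fun z hz => by
        rw [𝒯.interp_node Θ hz]
        exact hadm.mem_line z (𝒯.nodes_subset hz) }

end Admissible

/-! ### Estimates on one element -/

theorem bounded_convexHull (T : Finset (Sp d)) :
    Bornology.IsBounded (convexHull ℝ (T : Set (Sp d))) :=
  (T.finite_toSet.isCompact_convexHull ℝ).isBounded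

theorem norm_sub_le_diam {T : Finset (Sp d)} {x z : Sp d}
    (hx : x ∈ convexHull ℝ (T : Set (Sp d))) (hz : z ∈ T) :
    ‖z - x‖ ≤ Metric.diam (convexHull ℝ (T : Set (Sp d))) := by
  rw [← dist_eq_norm]
  exact Metric.dist_le_diam_of_mem (bounded_convexHull T) (subset_convexHull ℝ _ hz) hx

theorem diam_pos (hd : 0 < d) {T : Finset (Sp d)} (hT : T.card = d + 1) :
    0 < Metric.diam (convexHull ℝ (T : Set (Sp d))) := by
  obtain ⟨z, hz, y, hy, hzy⟩ := Finset.one_lt_card.1 (show 1 < T.card by omega)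
  refine (norm_pos_iff.2 (sub_ne_zero.2 hzy)).trans_le
    (norm_sub_le_diam (subset_convexHull ℝ _ hy) hz)

theorem norm_gradient_hat_le_of_shapeRegular (𝒯 : Triangulation Ω) (hd : 0 < d) {σ : ℝ}
    (hσ : 0 < σ) (hsh : 𝒯.ShapeRegular σ) {T : Finset (Sp d)} (hT : T ∈ 𝒯.elements)
    {x : Sp d} (hx : x ∈ interior (convexHull ℝ (T : Set (Sp d)))) (z : Sp d) :
    ‖∇ (𝒯.hat z) x‖ ≤ 1 / (σ * Metric.diam (convexHull ℝ (T : Set (Sp d)))) := by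
  obtain ⟨c, hc⟩ := hsh T hT
  exact 𝒯.norm_gradient_hat_le hT hx z (mul_pos hσ (diam_pos hd hT.2)) hc

/-- If the nodal values of `v` on an element of diameter `D` are `ε D`-close to those of an affine
function with gradient `a`, the gradient of the interpolant is close to `a`. -/
theorem norm_gradient_interp_sub_le (𝒯 : Triangulation Ω) (hd : 0 < d) {σ : ℝ}
    (hσ : 0 < σ) (hsh : 𝒯.ShapeRegular σ) {T : Finset (Sp d)} (hT : T ∈ 𝒯.elements)
    {x : Sp d} (hx : x ∈ interior (convexHull ℝ (T : Set (Sp d)))) {v : Sp d → ℝ} {α ε : ℝ}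
    {a : Sp d} (h : ∀ z ∈ T, |v z - α - inner ℝ a (z - x)| ≤
      ε * Metric.diam (convexHull ℝ (T : Set (Sp d)))) :
    ‖∇ (𝒯.interp v) x - a‖ ≤ (d + 1) * (ε / σ) := by
  set D := Metric.diam (convexHull ℝ (T : Set (Sp d))) with hDdef
  have hD : 0 < D := diam_pos hd hT.2
  have e : ∇ (𝒯.interp v) x - a =
      ∑ z ∈ T, (v z - α - inner ℝ a (z - x)) • ∇ (𝒯.hat z) x := by
    simp only [sub_smul, Finset.sum_sub_distrib, 𝒯.gradient_interp v hT hx,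
      𝒯.sum_inner_smul_gradient_hat hT hx a, ← Finset.smul_sum, 𝒯.sum_gradient_hat hT hx]
    simp
  rw [e]
  refine (norm_sum_le_of_le T (f := fun z => (v z - α - inner ℝ a (z - x)) • ∇ (𝒯.hat z) x)
    (n := fun _ => ε / σ) fun z hz => ?_).trans_eq ?_
  · rw [norm_smul, Real.norm_eq_abs]
    calc _ ≤ ε * D * (1 / (σ * D)) := by
          have := 𝒯.norm_gradient_hat_le_of_shapeRegular hd hσ hsh hT hx z
          have h0 := (abs_nonneg _).trans (h z hz)
          exact mul_le_mul (h z hz) this (norm_nonneg _) h0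
      _ = ε / σ := by field_simp
  · simp [hT.2]

theorem norm_gradient_interp_le (𝒯 : Triangulation Ω) (hd : 0 < d) {σ : ℝ}
    (hσ : 0 < σ) (hsh : 𝒯.ShapeRegular σ) {T : Finset (Sp d)} (hT : T ∈ 𝒯.elements)
    {x : Sp d} (hx : x ∈ interior (convexHull ℝ (T : Set (Sp d)))) {v : Sp d → ℝ} {K : ℝ≥0}
    (hv : LipschitzOnWith K v (closure Ω)) :
    ‖∇ (𝒯.interp v) x‖ ≤ (d + 1) * (K / σ) := by
  -- A K-Lipschitz function is within K D of the constant `v x`, an affine function with gradient 0.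
  have := 𝒯.norm_gradient_interp_sub_le hd hσ hsh hT hx (v := v) (α := v x) (ε := K) (a := 0)
    fun z hz => ?_
  · simpa using this
  · have h1 := hv.norm_sub_le (𝒯.nodes_subset (𝒯.subset_nodes hT.1 hz))
      (𝒯.convexHull_subset hT.1 (interior_subset hx))
    have h2 := norm_sub_le_diam (interior_subset hx) hz
    rw [inner_zero_left, sub_zero, ← Real.norm_eq_abs]
    exact h1.trans (by gcongr)

/-- The integrand of the consistency error of the discrete energy. -/
noncomputable def excess (𝒯 : Triangulation Ω) (s : Sp d → ℝ) (Θ : Sp d → Mat d) (x : Sp d) : ℝ :=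
  ∑ z ∈ 𝒯.nodes, ∑ y ∈ 𝒯.nodes, inner ℝ (∇ (𝒯.hat z) x) (∇ (𝒯.hat y) x) *
    ((s z - s y) ^ 2 * frobSq (Θ z - Θ y))

theorem sum_nodes_eq (𝒯 : Triangulation Ω) {T : Finset (Sp d)} (hT : T ∈ 𝒯.elements)
    {x : Sp d} (hx : x ∈ interior (convexHull ℝ (T : Set (Sp d)))) (c : Sp d → Sp d → ℝ) :
    ∑ z ∈ 𝒯.nodes, ∑ y ∈ 𝒯.nodes, inner ℝ (∇ (𝒯.hat z) x) (∇ (𝒯.hat y) x) * c z y =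
      ∑ z ∈ T, ∑ y ∈ T, inner ℝ (∇ (𝒯.hat z) x) (∇ (𝒯.hat y) x) * c z y := by
  have hsub := 𝒯.subset_nodes hT.1
  symm
  calc _ = ∑ z ∈ T, ∑ y ∈ 𝒯.nodes, inner ℝ (∇ (𝒯.hat z) x) (∇ (𝒯.hat y) x) * c z y :=
        Finset.sum_congr rfl fun z _ => Finset.sum_subset hsub fun y _ hy => by
          rw [𝒯.gradient_hat_of_notMem hT hx hy, inner_zero_right, zero_mul]
    _ = _ := Finset.sum_subset hsub fun z _ hz => by
          simp [𝒯.gradient_hat_of_notMem hT hx hz]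

/-- The two hat gradients cost 1/(σD)², which the factor D² in the hypothesis compensates; there are
(d + 1)² pairs of vertices. -/
theorem abs_excess_le (𝒯 : Triangulation Ω) (hd : 0 < d) {σ : ℝ}
    (hσ : 0 < σ) (hsh : 𝒯.ShapeRegular σ) {T : Finset (Sp d)} (hT : T ∈ 𝒯.elements)
    {x : Sp d} (hx : x ∈ interior (convexHull ℝ (T : Set (Sp d)))) {s : Sp d → ℝ}
    {Θ : Sp d → Mat d} {ε : ℝ}
    (h : ∀ z ∈ T, ∀ y ∈ T, (s z - s y) ^ 2 * frobSq (Θ z - Θ y) ≤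
      ε * Metric.diam (convexHull ℝ (T : Set (Sp d))) ^ 2) :
    |𝒯.excess s Θ x| ≤ (d + 1) ^ 2 * (ε / σ ^ 2) := by
  set D := Metric.diam (convexHull ℝ (T : Set (Sp d))) with hDdef
  have hD : 0 < D := diam_pos hd hT.2
  rw [excess, 𝒯.sum_nodes_eq hT hx]
  have hb : ∀ z ∈ T, ∀ y ∈ T, |inner ℝ (∇ (𝒯.hat z) x) (∇ (𝒯.hat y) x) *
      ((s z - s y) ^ 2 * frobSq (Θ z - Θ y))| ≤ ε / σ ^ 2 := fun z hz y hy => by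
    have h1 := 𝒯.norm_gradient_hat_le_of_shapeRegular hd hσ hsh hT hx
    have h2 : |inner ℝ (∇ (𝒯.hat z) x) (∇ (𝒯.hat y) x)| ≤ 1 / (σ * D) * (1 / (σ * D)) :=
      (abs_real_inner_le_norm _ _).trans
        (mul_le_mul (h1 z) (h1 y) (norm_nonneg _) (by positivity))
    have h0 : 0 ≤ (s z - s y) ^ 2 * frobSq (Θ z - Θ y) :=
      mul_nonneg (sq_nonneg _) (frobSq_nonneg _)
    rw [abs_mul, abs_of_nonneg h0]
    calc _ ≤ 1 / (σ * D) * (1 / (σ * D)) * (ε * D ^ 2) :=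
          mul_le_mul h2 (h z hz y hy) h0 (by positivity)
      _ = ε / σ ^ 2 := by field_simp
  calc _ ≤ ∑ z ∈ T, ∑ y ∈ T, ε / σ ^ 2 :=
        (Finset.abs_sum_le_sum_abs _ _).trans (Finset.sum_le_sum fun z hz =>
          (Finset.abs_sum_le_sum_abs _ _).trans (Finset.sum_le_sum fun y hy => hb z hz y hy))
    _ = _ := by simp [hT.2]; ring

end Triangulation
end UniaxialLdG

namespace UniaxialLdG

theorem frobSq_sub_le {d : ℕ} (A B C : Mat d) :
    frobSq (A - B) ≤ 2 * frobSq (A - C) + 2 * frobSq (B - C) := by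
  simp only [frobSq, Finset.mul_sum, ← Finset.sum_add_distrib]
  refine Finset.sum_le_sum fun i _ => Finset.sum_le_sum fun j _ => ?_
  simp only [Matrix.sub_apply]
  nlinarith [sq_nonneg (A i j - C i j + (B i j - C i j))]

theorem tendsto_of_eventually_norm_sub_le_mul {ι E : Type*} [NormedAddCommGroup E] {l : Filter ι}
    {f : ι → E} {a : E} {C : ℝ} (h : ∀ ε > 0, ∀ᶠ n in l, ‖f n - a‖ ≤ C * ε) :
    Tendsto f l (𝓝 a) := by
  rw [Metric.tendsto_nhds]
  intro ε hε
  have hC : 0 < |C| + 1 := by positivity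
  filter_upwards [h (ε / (|C| + 1)) (by positivity)] with n hn
  rw [dist_eq_norm]
  refine hn.trans_lt ?_
  rw [← mul_div_assoc, div_lt_iff₀ hC]
  nlinarith [le_abs_self C]

namespace Triangulation

variable {d : ℕ} {Ω : Set (Sp d)}

theorem sum_sum_inner_mul_frobSq {ι E : Type*} [NormedAddCommGroup E] [InnerProductSpace ℝ E]
    (T : Finset ι) (b : ι → E) (hb : ∑ z ∈ T, b z = 0) (V : ι → Mat d) :
    ∑ z ∈ T, ∑ y ∈ T, inner ℝ (b z) (b y) * frobSq (V z - V y) =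
      -2 * ∑ i, ∑ j, ‖∑ z ∈ T, V z i j • b z‖ ^ 2 := by
  have h : ∀ i j, ∑ z ∈ T, ∑ y ∈ T, inner ℝ (b z) (b y) * (V z i j - V y i j) ^ 2 =
      -2 * ‖∑ z ∈ T, V z i j • b z‖ ^ 2 := fun i j => sum_sum_inner_mul_sq T b hb _
  simp only [Finset.mul_sum (a := (-2 : ℝ)), ← h]
  simp only [frobSq, Finset.mul_sum, Matrix.sub_apply]
  have h2 : ∀ z, ∑ y ∈ T, ∑ i, ∑ j, inner ℝ (b z) (b y) * (V z i j - V y i j) ^ 2 =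
      ∑ i, ∑ j, ∑ y ∈ T, inner ℝ (b z) (b y) * (V z i j - V y i j) ^ 2 := fun z => by
    rw [Finset.sum_comm]
    exact Finset.sum_congr rfl fun i _ => Finset.sum_comm
  simp only [h2]
  rw [Finset.sum_comm]
  exact Finset.sum_congr rfl fun i _ => Finset.sum_comm

theorem gradient_interp_apply (𝒯 : Triangulation Ω) (hΩ : IsOpen Ω) (V : Sp d → Mat d) {x : Sp d}
    (hx : x ∈ Ω) (i j : Fin d) :
    ∇ (fun y => 𝒯.interp V y i j) x = ∇ (𝒯.interp fun y => V y i j) x := by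
  have : (fun y => 𝒯.interp V y i j) =ᶠ[𝓝 x] 𝒯.interp fun y => V y i j := by
    filter_upwards [hΩ.mem_nhds hx] with y hy using 𝒯.interp_apply V (subset_closure hy) i j
  exact this.gradient.eq_of_nhds

/-! ### Integrals over a fixed mesh -/

theorem ae_norm_gradient_interp_le (𝒯 : Triangulation Ω) (hd : 0 < d) (hΩ : IsOpen Ω) {σ : ℝ}
    (hσ : 0 < σ) (hsh : 𝒯.ShapeRegular σ) {v : Sp d → ℝ} {K : ℝ≥0}
    (hv : LipschitzOnWith K v (closure Ω)) :
    ∀ᵐ x ∂(volume.restrict Ω), ‖∇ (𝒯.interp v) x‖ ≤ (d + 1) * (K / σ) := by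
  filter_upwards [𝒯.ae_mem_interior hΩ] with x ⟨T, hT, hx⟩
  exact 𝒯.norm_gradient_interp_le hd hσ hsh hT hx hv

theorem integrableOn_inner_gradient_hat (𝒯 : Triangulation Ω) (hd : 0 < d) (hΩ : IsOpen Ω) {σ : ℝ}
    (hσ : 0 < σ) (hsh : 𝒯.ShapeRegular σ) (z y : Sp d) :
    IntegrableOn (fun x => inner ℝ (∇ (𝒯.hat z) x) (∇ (𝒯.hat y) x)) Ω := by
  have : IsFiniteMeasure (volume.restrict Ω) := ⟨by simpa using 𝒯.volume_lt_top⟩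
  -- This bound is a maximum over the elements of one mesh; it is not uniform in h and serves only
  -- for integrability.
  obtain ⟨C, hC⟩ := (𝒯.finite_elements.image fun T : Finset (Sp d) =>
    1 / (σ * Metric.diam (convexHull ℝ (T : Set (Sp d))))).bddAbove
  have hb : ∀ᵐ x ∂(volume.restrict Ω), ∀ z, ‖∇ (𝒯.hat z) x‖ ≤ C := by
    filter_upwards [𝒯.ae_mem_interior hΩ] with x ⟨T, hT, hx⟩ z
    exact (𝒯.norm_gradient_hat_le_of_shapeRegular hd hσ hsh hT hx z).trans
      (hC (mem_image_of_mem _ hT))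
  refine Integrable.of_bound
    ((gradient_measurable _).inner (gradient_measurable _)).aestronglyMeasurable (C * C) ?_
  filter_upwards [hb] with x hx
  exact (norm_inner_le_norm _ _).trans
    (mul_le_mul (hx z) (hx y) (norm_nonneg _) ((norm_nonneg _).trans (hx z)))

theorem measurable_excess (𝒯 : Triangulation Ω) (s : Sp d → ℝ) (Θ : Sp d → Mat d) :
    Measurable (𝒯.excess s Θ) :=
  Finset.measurable_sum _ fun _ _ => Finset.measurable_sum _ fun _ _ =>
    ((gradient_measurable _).inner (gradient_measurable _)).mul_const _

theorem integrableOn_excess (𝒯 : Triangulation Ω) (hd : 0 < d) (hΩ : IsOpen Ω) {σ : ℝ}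
    (hσ : 0 < σ) (hsh : 𝒯.ShapeRegular σ) (s : Sp d → ℝ) (Θ : Sp d → Mat d) :
    IntegrableOn (𝒯.excess s Θ) Ω :=
  integrable_finsetSum _ fun _ _ => integrable_finsetSum _ fun _ _ =>
    (𝒯.integrableOn_inner_gradient_hat hd hΩ hσ hsh _ _).mul_const _

theorem integrableOn_sq_norm_gradient_interp (𝒯 : Triangulation Ω) (hd : 0 < d) (hΩ : IsOpen Ω)
    {σ : ℝ} (hσ : 0 < σ) (hsh : 𝒯.ShapeRegular σ) {v : Sp d → ℝ} {K : ℝ≥0}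
    (hv : LipschitzOnWith K v (closure Ω)) :
    IntegrableOn (fun x => ‖∇ (𝒯.interp v) x‖ ^ 2) Ω :=
  integrableOn_sq_norm_gradient 𝒯.volume_lt_top (𝒯.ae_norm_gradient_interp_le hd hΩ hσ hsh hv)

theorem integrableOn_matGradSq_interp (𝒯 : Triangulation Ω) (hd : 0 < d) (hΩ : IsOpen Ω)
    {σ : ℝ} (hσ : 0 < σ) (hsh : 𝒯.ShapeRegular σ) {V : Sp d → Mat d} {L : ℝ≥0}
    (hV : ∀ i j, LipschitzOnWith L (fun x => V x i j) (closure Ω)) :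
    IntegrableOn (fun x => matGradSq (𝒯.interp V) x) Ω :=
  integrable_finsetSum _ fun i _ => integrable_finsetSum _ fun j _ =>
    (𝒯.integrableOn_sq_norm_gradient_interp hd hΩ hσ hsh (hV i j)).congr
      ((ae_restrict_mem hΩ.measurableSet).mono fun x hx => by
        simp only [𝒯.gradient_interp_apply hΩ V hx])

theorem integral_matGradSq_interp (𝒯 : Triangulation Ω) (hd : 0 < d) (hΩ : IsOpen Ω)
    {σ : ℝ} (hσ : 0 < σ) (hsh : 𝒯.ShapeRegular σ) {V : Sp d → Mat d} {L : ℝ≥0}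
    (hV : ∀ i j, LipschitzOnWith L (fun x => V x i j) (closure Ω)) :
    ∫ x in Ω, matGradSq (𝒯.interp V) x =
      ∑ i, ∑ j, ∫ x in Ω, ‖∇ (𝒯.interp fun y => V y i j) x‖ ^ 2 := by
  have h : ∀ i j, IntegrableOn (fun x => ‖∇ (𝒯.interp fun y => V y i j) x‖ ^ 2) Ω := fun i j =>
    𝒯.integrableOn_sq_norm_gradient_interp hd hΩ hσ hsh (hV i j)
  have h2 : ∫ x in Ω, matGradSq (𝒯.interp V) x =
      ∫ x in Ω, ∑ i, ∑ j, ‖∇ (𝒯.interp fun y => V y i j) x‖ ^ 2 :=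
    setIntegral_congr_fun hΩ.measurableSet fun x hx => by
      simp only [matGradSq, 𝒯.gradient_interp_apply hΩ V hx]
  rw [h2, integral_finsetSum _ fun i _ => integrable_finsetSum _ fun j _ => h i j]
  exact Finset.sum_congr rfl fun i _ => integral_finsetSum _ fun j _ => h i j

/-- The discrete energies differ by the integral of `excess`. -/
theorem discreteEnergy_eq (𝒯 : Triangulation Ω) (hd : 0 < d) (hΩ : IsOpen Ω)
    {σ : ℝ} (hσ : 0 < σ) (hsh : 𝒯.ShapeRegular σ) {g : Sp d → ℝ} {M : Sp d → Mat d}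
    {Γs ΓΘ : Set (Sp d)} {s : Sp d → ℝ} {U Θ : Sp d → Mat d}
    (hadm : IsLipschitzAdmissible Ω g M Γs ΓΘ s U Θ) :
    𝒯.discreteEnergy (𝒯.interp s) (𝒯.interp Θ) =
      energyTilde Ω (𝒯.interp s) (𝒯.interp U) - 1 / 8 * ∫ x in Ω, 𝒯.excess s Θ x := by
  obtain ⟨K, hK⟩ := hadm.lipschitz_s
  obtain ⟨L, hL⟩ := hadm.lipschitz_U
  -- The total coefficient of the stiffness entry of z and y in the discrete energy.
  set c : Sp d → Sp d → ℝ := fun z y => ((d : ℝ) - 1) / (4 * d) * (s z - s y) ^ 2 +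
    1 / 4 * ((s z ^ 2 + s y ^ 2) / 2 * frobSq (Θ z - Θ y)) with hc
  have e1 : 𝒯.discreteEnergy (𝒯.interp s) (𝒯.interp Θ) =
      ∑ z ∈ 𝒯.nodes, ∑ y ∈ 𝒯.nodes, 𝒯.stiffness z y * c z y := by
    simp only [discreteEnergy, Finset.mul_sum, ← Finset.sum_add_distrib]
    refine Finset.sum_congr rfl fun z hz => Finset.sum_congr rfl fun y hy => ?_
    rw [𝒯.interp_node s hz, 𝒯.interp_node s hy, 𝒯.interp_node Θ hz, 𝒯.interp_node Θ hy, hc]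
    ring
  have hI : ∀ z y, IntegrableOn
      (fun x => inner ℝ (∇ (𝒯.hat z) x) (∇ (𝒯.hat y) x) * -c z y) Ω := fun z y =>
    (𝒯.integrableOn_inner_gradient_hat hd hΩ hσ hsh z y).mul_const _
  have e2 : ∑ z ∈ 𝒯.nodes, ∑ y ∈ 𝒯.nodes, 𝒯.stiffness z y * c z y =
      ∫ x in Ω, ∑ z ∈ 𝒯.nodes, ∑ y ∈ 𝒯.nodes,
        inner ℝ (∇ (𝒯.hat z) x) (∇ (𝒯.hat y) x) * -c z y := by
    rw [integral_finsetSum _ fun z _ => integrable_finsetSum _ fun y _ => hI z y]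
    refine Finset.sum_congr rfl fun z _ => ?_
    rw [integral_finsetSum _ fun y _ => hI z y]
    refine Finset.sum_congr rfl fun y _ => ?_
    rw [integral_mul_const, stiffness]
    ring
  have hA := 𝒯.integrableOn_sq_norm_gradient_interp hd hΩ hσ hsh hK
  have hB := 𝒯.integrableOn_matGradSq_interp hd hΩ hσ hsh hL
  have hE := 𝒯.integrableOn_excess hd hΩ hσ hsh s Θ
  have e3 : energyTilde Ω (𝒯.interp s) (𝒯.interp U) - 1 / 8 * ∫ x in Ω, 𝒯.excess s Θ x =
      ∫ x in Ω, (1 / 2 * (-(1 / (d : ℝ)) * ‖∇ (𝒯.interp s) x‖ ^ 2 + matGradSq (𝒯.interp U) x) -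
        1 / 8 * 𝒯.excess s Θ x) := by
    have hAB : IntegrableOn (fun x => -(1 / (d : ℝ)) * ‖∇ (𝒯.interp s) x‖ ^ 2 +
        matGradSq (𝒯.interp U) x) Ω := (hA.const_mul _).add hB
    rw [integral_sub (hAB.const_mul _) (hE.const_mul _),
      integral_const_mul, integral_const_mul, integral_add (hA.const_mul _) hB, integral_const_mul,
      energyTilde]
  rw [e1, e2, e3]
  refine integral_congr_ae ?_
  filter_upwards [𝒯.ae_mem_interior hΩ, ae_restrict_mem hΩ.measurableSet] with x ⟨T, hT, hx⟩ hxΩ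
  have hb := 𝒯.sum_gradient_hat hT hx
  have hq := sum_sum_inner_mul_sq T _ hb s
  have hq2 := sum_sum_inner_mul_frobSq T _ hb U
  have hd' : (d : ℝ) ≠ 0 := by positivity
  have hm : matGradSq (𝒯.interp U) x = ∑ i, ∑ j, ‖∑ z ∈ T, U z i j • ∇ (𝒯.hat z) x‖ ^ 2 := by
    simp only [matGradSq, 𝒯.gradient_interp_apply hΩ U hxΩ, 𝒯.gradient_interp _ hT hx]
  rw [𝒯.sum_nodes_eq hT hx, excess, 𝒯.sum_nodes_eq hT hx, hm, 𝒯.gradient_interp s hT hx]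
  have h1 : ‖∑ z ∈ T, s z • ∇ (𝒯.hat z) x‖ ^ 2 = -(1 / 2) * ∑ z ∈ T, ∑ y ∈ T,
      inner ℝ (∇ (𝒯.hat z) x) (∇ (𝒯.hat y) x) * (s z - s y) ^ 2 := by rw [hq]; ring
  have h2 : ∑ i, ∑ j, ‖∑ z ∈ T, U z i j • ∇ (𝒯.hat z) x‖ ^ 2 = -(1 / 2) * ∑ z ∈ T, ∑ y ∈ T,
      inner ℝ (∇ (𝒯.hat z) x) (∇ (𝒯.hat y) x) * frobSq (U z - U y) := by rw [hq2]; ring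
  rw [h1, h2]
  simp only [Finset.mul_sum, ← Finset.sum_add_distrib, ← Finset.sum_sub_distrib]
  refine Finset.sum_congr rfl fun z hz => Finset.sum_congr rfl fun y hy => ?_
  have hz' := 𝒯.nodes_subset (𝒯.subset_nodes hT.1 hz)
  have hy' := 𝒯.nodes_subset (𝒯.subset_nodes hT.1 hy)
  rw [hadm.eq_smul z hz', hadm.eq_smul y hy']
  -- The squared differences of s collect the coefficient (d-1)/(4d) - 1/4 = -1/(4d), as in Ẽʰ; the
  -- remainder is one eighth of the excess term.
  simp only [hc, average_mul_frobSq_sub (hadm.mem_line z hz') (hadm.mem_line y hy')]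
  field_simp
  ring

end Triangulation

/-! ### Limits -/

section Limits

open Triangulation

variable {d : ℕ} {Ω : Set (Sp d)} {H : Set ℝ} {𝒯 : ℝ → Triangulation Ω} {σ : ℝ} {u : ℕ → ℝ}

/-- Element diameters are at most h → 0, so the vertices of elements containing x converge to x. -/
theorem eventually_forall_vertices (hsize : ∀ h ∈ H, (𝒯 h).SizeLE h)
    (hu : Tendsto u atTop (𝓝[H] 0)) {x : Sp d} {P : Sp d → Prop} (hP : ∀ᶠ y in 𝓝 x, P y) :
    ∀ᶠ n in atTop, u n ∈ H ∧ ∀ T ∈ (𝒯 (u n)).elements, x ∈ convexHull ℝ (T : Set (Sp d)) →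
      ∀ z ∈ T, P z := by
  obtain ⟨δ, hδ, hP⟩ := Metric.eventually_nhds_iff_ball.1 hP
  have h0 : ∀ᶠ h in 𝓝[H] (0 : ℝ), h ∈ H ∧ h < δ :=
    eventually_mem_nhdsWithin.and (eventually_nhdsWithin_of_eventually_nhds (gt_mem_nhds hδ))
  filter_upwards [hu.eventually h0] with n hn
  refine ⟨hn.1, fun T hT hx z hz => hP z ?_⟩
  rw [mem_ball_iff_norm]
  exact ((norm_sub_le_diam hx hz).trans (hsize _ hn.1 T hT)).trans_lt hn.2

theorem eventually_abs_taylor_le (hsize : ∀ h ∈ H, (𝒯 h).SizeLE h)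
    (hu : Tendsto u atTop (𝓝[H] 0)) {x : Sp d} {v : Sp d → ℝ} (hv : DifferentiableAt ℝ v x)
    {ε : ℝ} (hε : 0 < ε) :
    ∀ᶠ n in atTop, u n ∈ H ∧ ∀ T ∈ (𝒯 (u n)).elements, x ∈ convexHull ℝ (T : Set (Sp d)) →
      ∀ z ∈ T, |v z - v x - inner ℝ (∇ v x) (z - x)| ≤
        ε * Metric.diam (convexHull ℝ (T : Set (Sp d))) := by
  have h := (hasFDerivAt_iff_isLittleO.1 (hasFDerivAt_toDual_gradient hv)).def hε
  filter_upwards [eventually_forall_vertices hsize hu h] with n hn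
  refine ⟨hn.1, fun T hT hx z hz => ?_⟩
  have h1 := hn.2 T hT hx z hz
  rw [Real.norm_eq_abs, InnerProductSpace.toDual_apply_apply] at h1
  exact h1.trans (mul_le_mul_of_nonneg_left (norm_sub_le_diam hx hz) hε.le)

theorem tendsto_gradient_interp (hd : 0 < d) (hsize : ∀ h ∈ H, (𝒯 h).SizeLE h) (hσ : 0 < σ)
    (hshape : ∀ h ∈ H, (𝒯 h).ShapeRegular σ) (hu : Tendsto u atTop (𝓝[H] 0)) {x : Sp d}
    (hx : ∀ n, ∃ T ∈ (𝒯 (u n)).elements, x ∈ interior (convexHull ℝ (T : Set (Sp d))))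
    {v : Sp d → ℝ} (hv : DifferentiableAt ℝ v x) :
    Tendsto (fun n => ∇ ((𝒯 (u n)).interp v) x) atTop (𝓝 (∇ v x)) := by
  refine tendsto_of_eventually_norm_sub_le_mul (C := (d + 1) / σ) fun ε hε => ?_
  filter_upwards [eventually_abs_taylor_le hsize hu hv hε] with n ⟨hn, h⟩
  obtain ⟨T, hT, hxT⟩ := hx n
  refine ((𝒯 (u n)).norm_gradient_interp_sub_le hd hσ (hshape _ hn) hT hxT
    (h T hT (interior_subset hxT))).trans_eq ?_
  ring

/-- The excess is small once (s(z) - s(y))² |Θ(z) - Θ(y)|² = o(D²); the first factor supplies the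
smallness where s = 0, the second where s ≠ 0. -/
theorem tendsto_excess (hd : 0 < d) (hsize : ∀ h ∈ H, (𝒯 h).SizeLE h) (hσ : 0 < σ)
    (hshape : ∀ h ∈ H, (𝒯 h).ShapeRegular σ) (hu : Tendsto u atTop (𝓝[H] 0)) {x : Sp d}
    (hx : ∀ n, ∃ T ∈ (𝒯 (u n)).elements, x ∈ interior (convexHull ℝ (T : Set (Sp d))))
    {s : Sp d → ℝ} {Θ : Sp d → Mat d} (hΘ : ∀ y ∈ closure Ω, Θ y ∈ lineTensors d)
    {K : ℝ≥0} (hs : LipschitzOnWith K s (closure Ω)) (hds : DifferentiableAt ℝ s x)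
    (h0 : s x = 0 → ∇ s x = 0)
    (hc : s x ≠ 0 → ∀ i j, ContinuousAt (fun y => Θ y i j) x) :
    Tendsto (fun n => (𝒯 (u n)).excess s Θ x) atTop (𝓝 0) := by
  have hlip : ∀ n, ∀ T ∈ (𝒯 (u n)).elements, ∀ z ∈ T, ∀ y ∈ T,
      |s z - s y| ≤ K * Metric.diam (convexHull ℝ (T : Set (Sp d))) := fun n T hT z hz y hy => by
    have hmem := (𝒯 (u n)).subset_nodes hT.1
    have h1 := hs.norm_sub_le ((𝒯 (u n)).nodes_subset (hmem hz)) ((𝒯 (u n)).nodes_subset (hmem hy))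
    have h2 := norm_sub_le_diam (subset_convexHull ℝ _ hy) hz
    exact h1.trans (by gcongr)
  by_cases hsx : s x = 0
  -- One factor |s(z) - s(y)| is bounded by K D, the other by 2εD from Taylor at x, and |Θ(z) -
  -- Θ(y)|² by 4: together 8Kε D².
  · refine tendsto_of_eventually_norm_sub_le_mul (C := (d + 1) ^ 2 * (8 * K / σ ^ 2))
      fun ε hε => ?_
    filter_upwards [eventually_abs_taylor_le hsize hu hds hε] with n ⟨hn, h⟩
    obtain ⟨T, hT, hxT⟩ := hx n
    have h' := h T hT (interior_subset hxT)
    have hmem := (𝒯 (u n)).subset_nodes hT.1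
    rw [sub_zero, Real.norm_eq_abs]
    refine ((𝒯 (u n)).abs_excess_le hd hσ (hshape _ hn) hT hxT (ε := 8 * K * ε)
      fun z hz y hy => ?_).trans_eq (by ring)
    have hz' := h' z hz
    have hy' := h' y hy
    simp only [hsx, h0 hsx, sub_zero, inner_zero_left] at hz' hy'
    set D := Metric.diam (convexHull ℝ (T : Set (Sp d)))
    have h1 : |s z - s y| ≤ 2 * (ε * D) := (abs_sub _ _).trans (by linarith)
    have h2 := hlip n T hT z hz y hy
    have h3 : (s z - s y) ^ 2 ≤ K * D * (2 * (ε * D)) := by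
      rw [← sq_abs, sq]
      exact mul_le_mul h2 h1 (abs_nonneg _) ((abs_nonneg _).trans h2)
    have h4 := frobSq_sub_le_four (hΘ z ((𝒯 (u n)).nodes_subset (hmem hz)))
      (hΘ y ((𝒯 (u n)).nodes_subset (hmem hy)))
    calc _ ≤ K * D * (2 * (ε * D)) * 4 :=
          mul_le_mul h3 h4 (frobSq_nonneg _) ((sq_nonneg _).trans h3)
      _ = _ := by ring
  -- Here the squared difference of s is at most K² D², and continuity of Θ at x gives |Θ(z) -
  -- Θ(y)|² ≤ 2ε + 2ε.
  · refine tendsto_of_eventually_norm_sub_le_mul (C := (d + 1) ^ 2 * (4 * K ^ 2 / σ ^ 2))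
      fun ε hε => ?_
    have hlim : Tendsto (fun y => frobSq (Θ y - Θ x)) (𝓝 x) (𝓝 0) := by
      have : ContinuousAt (fun y => frobSq (Θ y - Θ x)) x := by
        simp only [frobSq, Matrix.sub_apply]
        exact tendsto_finsetSum _ fun i _ => tendsto_finsetSum _ fun j _ =>
          ((hc hsx i j).sub continuousAt_const).pow 2
      have h2 : frobSq (Θ x - Θ x) = 0 := by simp [frobSq]
      rwa [ContinuousAt, h2] at this
    filter_upwards [eventually_forall_vertices hsize hu (hlim.eventually (gt_mem_nhds hε))]
      with n ⟨hn, h⟩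
    obtain ⟨T, hT, hxT⟩ := hx n
    have h' := h T hT (interior_subset hxT)
    rw [sub_zero, Real.norm_eq_abs]
    refine ((𝒯 (u n)).abs_excess_le hd hσ (hshape _ hn) hT hxT (ε := 4 * K ^ 2 * ε)
      fun z hz y hy => ?_).trans_eq (by ring)
    set D := Metric.diam (convexHull ℝ (T : Set (Sp d)))
    have h2 := hlip n T hT z hz y hy
    have h3 : (s z - s y) ^ 2 ≤ (K * D) ^ 2 := by
      rw [← sq_abs]
      gcongr
    have h4 : frobSq (Θ z - Θ y) ≤ 4 * ε :=
      (frobSq_sub_le _ _ (Θ x)).trans (by linarith [h' z hz, h' y hy])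
    calc _ ≤ (K * D) ^ 2 * (4 * ε) :=
          mul_le_mul h3 h4 (frobSq_nonneg _) ((sq_nonneg _).trans h3)
      _ = _ := by ring

/-- Only countably many null sets may be discarded, which is why the limits h → 0 are taken along
sequences. -/
theorem ae_forall_mem_interior (hΩ : IsOpen Ω) (𝒯 : ℝ → Triangulation Ω) (u : ℕ → ℝ) :
    ∀ᵐ x ∂(volume.restrict Ω), ∀ n, ∃ T ∈ (𝒯 (u n)).elements,
      x ∈ interior (convexHull ℝ (T : Set (Sp d))) :=
  ae_all_iff.2 fun n => (𝒯 (u n)).ae_mem_interior hΩ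

theorem tendsto_integral_sq_norm_gradient_interp (hd : 0 < d) (hΩ : IsOpen Ω)
    (hsize : ∀ h ∈ H, (𝒯 h).SizeLE h) (hσ : 0 < σ)
    (hshape : ∀ h ∈ H, (𝒯 h).ShapeRegular σ) {v : Sp d → ℝ} {K : ℝ≥0}
    (hv : LipschitzOnWith K v (closure Ω)) :
    Tendsto (fun h => ∫ x in Ω, ‖∇ ((𝒯 h).interp v) x‖ ^ 2) (𝓝[H] 0)
      (𝓝 (∫ x in Ω, ‖∇ v x‖ ^ 2)) := by
  -- The mesh at index 0 is just some triangulation of Ω, showing that Ω has finite measure; 0 need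
  -- not lie in H.
  have : IsFiniteMeasure (volume.restrict Ω) := ⟨by simpa using (𝒯 0).volume_lt_top⟩
  refine tendsto_of_seq_tendsto fun u hu => ?_
  refine tendsto_integral_filter_of_dominated_convergence
    (fun _ => ((d + 1) * (K / σ)) ^ 2)
    (Eventually.of_forall fun n =>
      ((gradient_measurable _).norm.pow_const 2).aestronglyMeasurable) ?_
    (integrable_const _) ?_
  · filter_upwards [hu.eventually eventually_mem_nhdsWithin] with n hn
    filter_upwards [(𝒯 (u n)).ae_norm_gradient_interp_le hd hΩ hσ (hshape _ hn) hv] with x hx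
    rw [norm_pow, norm_norm]
    gcongr
  · filter_upwards [ae_forall_mem_interior hΩ 𝒯 u,
      ae_differentiableAt_of_lipschitzOn hΩ (hv.mono subset_closure)] with x hx hvx
    exact (tendsto_gradient_interp hd hsize hσ hshape hu hx hvx).norm.pow 2

theorem tendsto_integral_excess (hd : 0 < d) (hΩ : IsOpen Ω)
    (hsize : ∀ h ∈ H, (𝒯 h).SizeLE h) (hσ : 0 < σ)
    (hshape : ∀ h ∈ H, (𝒯 h).ShapeRegular σ) {g : Sp d → ℝ} {M : Sp d → Mat d}
    {Γs ΓΘ : Set (Sp d)} {s : Sp d → ℝ} {U Θ : Sp d → Mat d}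
    (hadm : IsLipschitzAdmissible Ω g M Γs ΓΘ s U Θ) :
    Tendsto (fun h => ∫ x in Ω, (𝒯 h).excess s Θ x) (𝓝[H] 0) (𝓝 0) := by
  have : IsFiniteMeasure (volume.restrict Ω) := ⟨by simpa using (𝒯 0).volume_lt_top⟩
  obtain ⟨K, hK⟩ := hadm.lipschitz_s
  refine tendsto_of_seq_tendsto fun u hu => ?_
  rw [← integral_zero (Sp d) ℝ (μ := volume.restrict Ω)]
  refine tendsto_integral_filter_of_dominated_convergence
    -- Lipschitz bound K² D² for s times the bound 4 for line tensors, valid for all h in H.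
    (fun _ => (d + 1) ^ 2 * (4 * K ^ 2 / σ ^ 2))
    (Eventually.of_forall fun n => ((𝒯 (u n)).measurable_excess s Θ).aestronglyMeasurable) ?_
    (integrable_const _) ?_
  · filter_upwards [hu.eventually eventually_mem_nhdsWithin] with n hn
    filter_upwards [(𝒯 (u n)).ae_mem_interior hΩ] with x ⟨T, hT, hx⟩
    refine (𝒯 (u n)).abs_excess_le hd hσ (hshape _ hn) hT hx fun z hz y hy => ?_
    have hz' := (𝒯 (u n)).nodes_subset ((𝒯 (u n)).subset_nodes hT.1 hz)
    have hy' := (𝒯 (u n)).nodes_subset ((𝒯 (u n)).subset_nodes hT.1 hy)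
    have h1 := hK.norm_sub_le hz' hy'
    have h2 := norm_sub_le_diam (subset_convexHull ℝ _ hy) hz
    have h4 := frobSq_sub_le_four (hadm.mem_line z hz') (hadm.mem_line y hy')
    calc (s z - s y) ^ 2 * frobSq (Θ z - Θ y)
        ≤ (K * Metric.diam (convexHull ℝ (T : Set (Sp d)))) ^ 2 * 4 := by
          refine mul_le_mul ?_ h4 (frobSq_nonneg _) (sq_nonneg _)
          rw [← sq_abs, ← Real.norm_eq_abs]
          have := h1.trans (mul_le_mul_of_nonneg_left h2 K.2)
          gcongr
      _ = _ := by ring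
  · filter_upwards [ae_forall_mem_interior hΩ 𝒯 u, ae_restrict_mem hΩ.measurableSet,
      ae_differentiableAt_of_lipschitzOn hΩ (hK.mono subset_closure),
      ae_gradient_eq_zero_of_eq_zero hΩ (hK.mono subset_closure)] with x hx hxΩ hsx h0
    exact tendsto_excess hd hsize hσ hshape hu hx hadm.mem_line hK hsx h0
      fun hs i j => hadm.continuousAt hΩ hxΩ hs i j

theorem tendsto_energyTilde_interp (hd : 0 < d) (hΩ : IsOpen Ω)
    (hsize : ∀ h ∈ H, (𝒯 h).SizeLE h) (hσ : 0 < σ)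
    (hshape : ∀ h ∈ H, (𝒯 h).ShapeRegular σ) {s : Sp d → ℝ} {U : Sp d → Mat d} {K L : ℝ≥0}
    (hs : LipschitzOnWith K s (closure Ω))
    (hU : ∀ i j, LipschitzOnWith L (fun x => U x i j) (closure Ω)) :
    Tendsto (fun h => energyTilde Ω ((𝒯 h).interp s) ((𝒯 h).interp U)) (𝓝[H] 0)
      (𝓝 (energyTilde Ω s U)) := by
  have hg : ∀ i j, IntegrableOn (fun x => ‖∇ (fun y => U y i j) x‖ ^ 2) Ω := fun i j =>
    integrableOn_sq_norm_gradient (𝒯 0).volume_lt_top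
      ((ae_restrict_mem hΩ.measurableSet).mono fun x hx =>
        norm_gradient_le_of_lipschitzOn hΩ ((hU i j).mono subset_closure) hx)
  have h1 : ∫ x in Ω, matGradSq U x = ∑ i, ∑ j, ∫ x in Ω, ‖∇ (fun y => U y i j) x‖ ^ 2 := by
    simp only [matGradSq]
    rw [integral_finsetSum _ fun i _ => integrable_finsetSum _ fun j _ => hg i j]
    exact Finset.sum_congr rfl fun i _ => integral_finsetSum _ fun j _ => hg i j
  have h2 : Tendsto (fun h => ∫ x in Ω, matGradSq ((𝒯 h).interp U) x) (𝓝[H] 0)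
      (𝓝 (∫ x in Ω, matGradSq U x)) := by
    rw [h1]
    refine Tendsto.congr' ?_ (tendsto_finsetSum _ fun i _ => tendsto_finsetSum _ fun j _ =>
      tendsto_integral_sq_norm_gradient_interp hd hΩ hsize hσ hshape (hU i j))
    filter_upwards [eventually_mem_nhdsWithin] with h hh
    exact ((𝒯 h).integral_matGradSq_interp hd hΩ hσ (hshape h hh) hU).symm
  exact (((tendsto_integral_sq_norm_gradient_interp hd hΩ hsize hσ hshape hs).const_mul _).add
    h2).const_mul _

end Limits
end UniaxialLdG
-- The main theorem.
theorem mainTheorem5 (d : ℕ) (hd : 2 ≤ d) (Ω : Set (UniaxialLdG.Sp d)) (hΩ : IsOpen Ω)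
    (g : UniaxialLdG.Sp d → ℝ) (R M : UniaxialLdG.Sp d → UniaxialLdG.Mat d)
    (Γs ΓU ΓΘ : Set (UniaxialLdG.Sp d))
    (hdata : UniaxialLdG.IsBoundaryData Ω g R M Γs ΓU ΓΘ)
    (s : UniaxialLdG.Sp d → ℝ) (U Θ : UniaxialLdG.Sp d → UniaxialLdG.Mat d)
    (hadm : UniaxialLdG.IsLipschitzAdmissible Ω g M Γs ΓΘ s U Θ)
    (H : Set ℝ) (hH : H ⊆ Set.Ioi 0)
    (𝒯 : ℝ → UniaxialLdG.Triangulation Ω)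
    (hsize : ∀ h ∈ H, (𝒯 h).SizeLE h)
    (hshape : ∃ σ : ℝ, 0 < σ ∧ ∀ h ∈ H, (𝒯 h).ShapeRegular σ)
    (hacute : ∀ h ∈ H, (𝒯 h).WeaklyAcute) :
    (∀ h ∈ H, (𝒯 h).Fits Γs → (𝒯 h).Fits ΓΘ →
      (𝒯 h).IsDiscreteAdmissible g R M Γs ΓU ΓΘ
        ((𝒯 h).interp s) ((𝒯 h).interp U) ((𝒯 h).interp Θ)) ∧
    UniaxialLdG.EnergyWellDefined Ω s U Θ ∧
    Tendsto (fun h => (𝒯 h).discreteEnergy ((𝒯 h).interp s) ((𝒯 h).interp Θ))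
      (𝓝[H] 0) (𝓝 (UniaxialLdG.energy Ω s Θ)) ∧
    Tendsto (fun h => UniaxialLdG.energyTilde Ω ((𝒯 h).interp s) ((𝒯 h).interp U))
      (𝓝[H] 0) (𝓝 (UniaxialLdG.energyTilde Ω s U)) ∧
    UniaxialLdG.energy Ω s Θ = UniaxialLdG.energyTilde Ω s U := by
  have hd0 : 0 < d := by omega
  obtain ⟨σ, hσ, hshape⟩ := hshape
  obtain ⟨K, hK⟩ := hadm.lipschitz_s
  obtain ⟨L, hL⟩ := hadm.lipschitz_U
  have hv := (𝒯 0).volume_lt_top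
  have hE := hadm.energy_eq_energyTilde hd0 hΩ hv
  have hT := UniaxialLdG.tendsto_energyTilde_interp hd0 hΩ hsize hσ hshape hK hL
  refine ⟨fun h _ hs hΘ => (𝒯 h).isDiscreteAdmissible_interp hdata hadm hs hΘ,
    hadm.energyWellDefined hΩ hv, ?_, hT, hE⟩
  rw [hE]
  have h1 := hT.sub
    ((UniaxialLdG.tendsto_integral_excess hd0 hΩ hsize hσ hshape hadm).const_mul (1 / 8))
  rw [mul_zero, sub_zero] at h1
  refine h1.congr' ?_
  filter_upwards [eventually_mem_nhdsWithin] with h hh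
  exact ((𝒯 h).discreteEnergy_eq hd0 hΩ hσ (hshape h hh) hadm).symm
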